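/- Let $d\ge 1$. Let $a:\mathbf R^d\to[0,\infty)$ be even, with $a(x)\ge c_a>0$ for $|x|<r_a$ (some $r_a,c_a>0$) and $a(x)(1+|x|^2)\in L^1(\mathbf R^d)$. Let $Y^\#_{\rm stiff},Y^\#_{\rm soft}\subset\mathbf R^d$ be disjoint open $\mathbf Z^d$-periodic sets whose union is dense in $\mathbf R^d$. Let $w$ be a measurable symmetric function on $\mathbf R^d\times\mathbf R^d$, $\mathbf Z^d$-periodic in each argument, with $0<\alpha_1<w<\alpha_2<\infty$ for some constants $\alpha_1,\alpha_2$, and put $$p(x,y)=w(x,y)\bigl(1-\mathbf 1_{Y^\#_{\rm stiff}}(x)\,\mathbf 1_{Y^\#_{\rm stiff}}(y)\bigr).$$ Let $\Pi=(0,l_1)\times\dots\times(0,l_d)$ with positive integers $l_1,\dots,l_d$. All $L^2$ spaces are over a fixed scalar field, $\mathbf R$ or $\mathbf C$, and $L^2(E)$, $E\subset \mathbf R^d$, is identified with the functions in $L^2(\mathbf R^d)$ that vanish a.e. outside $E$. For $\varepsilon>0$ let $\mathcal A_{\varepsilon,{\rm soft}}$ be the bounded self-adjoint operator on $L^2(\varepsilon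 Y^\#_{\rm soft}\cap\Pi)$ associated with the form $$a_{\varepsilon,{\rm soft}}(z,b)=\int_{\mathbf R^d}\int_{\mathbf R^d}a(\xi)\,p\Bigl(\frac x\varepsilon,\frac{x+\varepsilon\xi}\varepsilon\Bigr)\bigl(z(x+\varepsilon\xi)-z(x)\bigr)\bigl(b(x+\varepsilon\xi)-b(x)\bigr)\,dx\,d\xi$$ (with complex conjugation on one of the two factors in the complex case). Each vertex $v_j$, $j=1,\dots,2^d$, of the box is assigned the closed orthant $\mathbf R^d_{v_j}=\{x:\pm x_i\ge 0,\ i=1,\dots,d\}$, with the signs such that the translate $v_j+\mathbf R^d_{v_j}$ coincides with $\overline\Pi$ near $v_j$. Let $\mathcal A^{v_j}_{\rm soft}$ be the bounded operator on $L^2(\mathbf R^d_{v_j}\cap Y^\#_{\rm soft})$ given by $$\mathcal A^{v_j}_{\rm soft}z(y)=m(y)z(y)-2\cdot\mathbf 1_{\mathbf R^d_{v_j}\cap Y^\#_{\rm soft}}(y)\int_{\mathbf R^d}a(\xi)p(y,y+\xi)z(y+\xi)\,d\xi,\qquad m(y)=2\int_{\mathbf R^d}a(\xi)p(y,y+\xi)\,d\xi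 .$$ **Theorem.** As $N\to\infty$ ($N=1,2,\dots$), the spectra $\mathrm{Sp}(\mathcal A_{1/N,{\rm soft}})$ have a Hausdorff limit, and $$\mathop{\text{H-lim}}_{N\to\infty}\mathrm{Sp}(\mathcal A_{1/N,{\rm soft}})=\bigcup_{j=1}^{2^d}\mathrm{Sp}(\mathcal A^{v_j}_{\rm soft}).$$ That is: (i) every $\lambda$ in the right-hand side is the limit of a sequence $\lambda_N\in\mathrm{Sp}(\mathcal A_{1/N,{\rm soft}})$, $N\ge 1$; (ii) if $N_1<N_2<\dots$ and $\lambda_k\in\mathrm{Sp}(\mathcal A_{1/N_k,{\rm soft}})$ converge to $\lambda$, then $\lambda$ belongs to the right-hand side. -/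

import Mathlib

open MeasureTheory Filter Topology
open scoped ENNReal NNReal

namespace HighContrast

/-- The Euclidean space `ℝ^d`. -/
abbrev Space (d : ℕ) : Type := EuclideanSpace ℝ (Fin d)

/-- The lattice vector of `ℤ^d` with coordinates `k`, seen in `ℝ^d`. -/
def latticeVec {d : ℕ} (k : Fin d → ℤ) : Space d := WithLp.toLp 2 (fun i => (k i : ℝ))

/-- `T` is the Hausdorff limit of the sequence of sets `S 0, S 1, …`: every point of `T` is the
limit of a sequence of points `s N ∈ S N`, and every limit of points of the sets `S N`, taken along
the whole sequence or along any subsequence, lies in `T`. -/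
structure IsHausdorffLimit {X : Type*} [TopologicalSpace X] (S : ℕ → Set X) (T : Set X) :
    Prop where
  exists_tendsto : ∀ t ∈ T, ∃ s : ℕ → X, (∀ N, s N ∈ S N) ∧ Tendsto s atTop (𝓝 t)
  mem_of_tendsto : ∀ (φ : ℕ → ℕ) (s : ℕ → X) (t : X), StrictMono φ → (∀ k, s k ∈ S (φ k)) →
    Tendsto s atTop (𝓝 t) → t ∈ T

/-- The data of a periodic high-contrast convolution-type medium in `ℝ^d`, with its standing
assumptions: the convolution kernel `a`, the bounded coefficient `w`, and the `ℤ^d`-periodic open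
stiff and soft components. -/
structure Medium (d : ℕ) where
  /-- the convolution kernel -/
  a : Space d → ℝ
  /-- the coefficient from which the soft coefficient `p` is built -/
  w : Space d → Space d → ℝ
  /-- the stiff component (a periodic subset of `ℝ^d`) -/
  stiff : Set (Space d)
  /-- the soft component (a periodic subset of `ℝ^d`) -/
  soft : Set (Space d)
  a_nonneg : ∀ x, 0 ≤ a x
  a_even : ∀ x, a (-x) = a x
  a_elliptic : ∃ r > 0, ∃ c > 0, ∀ x, ‖x‖ < r → c ≤ a x
  a_integrable : Integrable (fun x => a x * (1 + ‖x‖ ^ 2)) volume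
  isOpen_stiff : IsOpen stiff
  isOpen_soft : IsOpen soft
  disjoint : Disjoint stiff soft
  closure_union : closure (stiff ∪ soft) = Set.univ
  stiff_periodic : ∀ (k : Fin d → ℤ) (x : Space d), x + latticeVec k ∈ stiff ↔ x ∈ stiff
  soft_periodic : ∀ (k : Fin d → ℤ) (x : Space d), x + latticeVec k ∈ soft ↔ x ∈ soft
  w_measurable : Measurable (Function.uncurry w)
  w_symm : ∀ x y, w x y = w y x
  w_periodic_left : ∀ (k : Fin d → ℤ) (x y : Space d), w (x + latticeVec k) y = w x y
  w_periodic_right : ∀ (k : Fin d → ℤ) (x y : Space d), w x (y + latticeVec k) = w x y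
  w_bounds : ∃ α₁ α₂ : ℝ, 0 < α₁ ∧ ∀ x y, α₁ < w x y ∧ w x y < α₂

/-- The open box `Π = (0, l₁) × ⋯ × (0, l_d)` with integer edge lengths. -/
def box {d : ℕ} (l : Fin d → ℕ) : Set (Space d) := {x | ∀ j, 0 < x j ∧ x j < (l j : ℝ)}

/-- The orthant attached to a vertex of the box. The vertex is encoded by `σ : Fin d → Bool`: its
`j`-th coordinate is the upper end of the `j`-th edge if `σ j = true`, and `0` otherwise; so the
translate of the orthant to the vertex coincides with the (closed) box near that vertex. -/
def orthant {d : ℕ} (σ : Fin d → Bool) : Set (Space d) :=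
  {x | ∀ j, if σ j = true then x j ≤ 0 else 0 ≤ x j}

theorem measurableSet_orthant {d : ℕ} (σ : Fin d → Bool) : MeasurableSet (orthant σ) := by
  have : orthant σ = ⋂ j, {x : Space d | if σ j = true then x j ≤ 0 else 0 ≤ x j} := by
    ext x; simp [orthant]
  rw [this]
  refine MeasurableSet.iInter fun j => ?_
  by_cases h : σ j = true
  · simp only [h, if_true]
    exact measurableSet_le (by fun_prop) measurable_const
  · simp only [h]
    exact measurableSet_le measurable_const (by fun_prop)

section L2On

variable {d : ℕ} (𝕜 : Type*) [RCLike 𝕜]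

/-- `L²(E)`, as the subspace of `L²(ℝ^d)` of the functions vanishing a.e. outside `E`. -/
def L2On (E : Set (Space d)) : Submodule 𝕜 (Lp 𝕜 2 (volume : Measure (Space d))) where
  carrier := {f | ∀ᵐ x, x ∉ E → f x = 0}
  add_mem' := by
    intro f g hf hg
    filter_upwards [hf, hg, Lp.coeFn_add f g] with x h1 h2 h3 hx
    rw [h3, Pi.add_apply, h1 hx, h2 hx, add_zero]
  zero_mem' := by
    filter_upwards [Lp.coeFn_zero 𝕜 2 (volume : Measure (Space d))] with x h1 _
    rw [h1]; rfl
  smul_mem' := by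
    intro c f hf
    filter_upwards [hf, Lp.coeFn_smul c f] with x h1 h3 hx
    rw [h3, Pi.smul_apply, h1 hx, smul_zero]

theorem isClosed_L2On (E : Set (Space d)) :
    IsClosed (L2On 𝕜 E : Set (Lp 𝕜 2 (volume : Measure (Space d)))) := by
  refine IsSeqClosed.isClosed ?_
  intro f g hf hfg
  obtain ⟨φ, -, hφ⟩ := (tendstoInMeasure_of_tendsto_Lp hfg).exists_seq_tendsto_ae
  have h := ae_all_iff.2 (fun n => (hf n : ∀ᵐ x, x ∉ E → f n x = 0))
  change ∀ᵐ x, x ∉ E → g x = 0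
  filter_upwards [hφ, h] with x h1 h2 hx
  have h3 : (fun i => f (φ i) x) = fun _ => 0 := funext fun i => h2 _ hx
  rw [h3] at h1
  exact (tendsto_nhds_unique h1 tendsto_const_nhds)

instance completeSpace_L2On (E : Set (Space d)) : CompleteSpace (L2On 𝕜 E) :=
  (isClosed_L2On 𝕜 E).completeSpace_coe

end L2On

namespace Medium

variable {d : ℕ} (M : Medium d)

/-- The soft coefficient `p(x, y) = w(x, y) (1 - 1_stiff(x) 1_stiff(y))`. -/
noncomputable def p (x y : Space d) : ℝ :=
  M.w x y * (1 - M.stiff.indicator (fun _ => 1) x * M.stiff.indicator (fun _ => 1) y)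

/-- The soft part of `S` at scale `ε`, that is `ε Y_soft ∩ S`. -/
def softPart (S : Set (Space d)) (ε : ℝ) : Set (Space d) := {x | ε⁻¹ • x ∈ M.soft ∧ x ∈ S}

theorem integrable_a : Integrable M.a volume := by
  have h : M.a = fun x => (M.a x * (1 + ‖x‖ ^ 2)) * (1 + ‖x‖ ^ 2)⁻¹ := by
    funext x
    have : (1 + ‖x‖ ^ 2) ≠ 0 := by positivity
    field_simp
  refine M.a_integrable.mono' ?_ (Eventually.of_forall fun x => ?_)
  · rw [h]
    refine M.a_integrable.aestronglyMeasurable.mul ?_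
    exact Measurable.aestronglyMeasurable (by fun_prop)
  · rw [Real.norm_of_nonneg (M.a_nonneg x)]
    exact le_mul_of_one_le_right (M.a_nonneg x) (by nlinarith [sq_nonneg ‖x‖])

theorem measurable_p : Measurable (Function.uncurry M.p) := by
  have h1 : Measurable (M.stiff.indicator (fun _ => (1 : ℝ))) :=
    measurable_const.indicator M.isOpen_stiff.measurableSet
  exact M.w_measurable.mul
    (measurable_const.sub ((h1.comp measurable_fst).mul (h1.comp measurable_snd)))

theorem exists_p_le : ∃ C : ℝ≥0, ∀ x y, |M.p x y| ≤ C := by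
  obtain ⟨α₁, α₂, h0, h⟩ := M.w_bounds
  have hα : 0 ≤ α₂ := by have := h 0 0; linarith
  refine ⟨⟨α₂, hα⟩, fun x y => ?_⟩
  have h1 := h x y
  change |M.p x y| ≤ α₂
  simp only [p, Set.indicator]
  have h2 := abs_of_pos (h0.trans h1.1)
  have h3 := h1.2.le
  split_ifs <;> simp [h2, h3, hα]

section Form

variable {𝕜 : Type*} [RCLike 𝕜]

/-- The integrand of the form of the soft component at scale `ε`. -/
noncomputable def formIntegrand (ε : ℝ) (u v : Space d → 𝕜) (ξ x : Space d) : 𝕜 :=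
  ((M.a ξ * M.p (ε⁻¹ • x) (ε⁻¹ • (x + ε • ξ)) : ℝ) : 𝕜) *
    (starRingEnd 𝕜 (u (x + ε • ξ) - u x) * (v (x + ε • ξ) - v x))

/-- The form of the soft component at scale `ε`,
`a_{ε,soft}(u, v) = ∫∫ a(ξ) p(x/ε, (x+εξ)/ε) conj(u(x+εξ) - u(x)) (v(x+εξ) - v(x)) dx dξ`
(conjugate-linear in the first variable, like the inner product; bilinear when `𝕜 = ℝ`). -/
noncomputable def softForm (ε : ℝ) (u v : Space d → 𝕜) : 𝕜 :=
  ∫ ξ, ∫ x, M.formIntegrand ε u v ξ x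

theorem eLpNorm_diff_le {u : Space d → 𝕜} (hu : Measurable u) (c : Space d) :
    eLpNorm (fun x => u (x + c) - u x) 2 volume ≤ 2 * eLpNorm u 2 volume := by
  have h1 : eLpNorm (fun x => u (x + c)) 2 volume = eLpNorm u 2 volume :=
    eLpNorm_comp_measurePreserving hu.aestronglyMeasurable (measurePreserving_add_right volume c)
  have h2 := eLpNorm_sub_le (μ := (volume : Measure (Space d))) (p := 2)
    (f := fun x => u (x + c)) (g := u)
    (hu.comp (measurable_add_const c)).aestronglyMeasurable hu.aestronglyMeasurable (by norm_num)
  rw [h1, ← two_mul] at h2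
  exact h2

theorem aestronglyMeasurable_formIntegrand (ε : ℝ) {u v : Space d → 𝕜} (hu : Measurable u)
    (hv : Measurable v) :
    AEStronglyMeasurable (Function.uncurry (M.formIntegrand ε u v))
      ((volume : Measure (Space d)).prod volume) := by
  have ha : AEMeasurable (fun q : Space d × Space d => M.a q.1)
      ((volume : Measure (Space d)).prod volume) :=
    M.integrable_a.aestronglyMeasurable.aemeasurable.comp_quasiMeasurePreserving
      Measure.quasiMeasurePreserving_fst
  have hp : Measurable (fun q : Space d × Space d => M.p (ε⁻¹ • q.2) (ε⁻¹ • (q.2 + ε • q.1))) :=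
    M.measurable_p.comp (f := fun q : Space d × Space d =>
      (ε⁻¹ • q.2, ε⁻¹ • (q.2 + ε • q.1))) (by fun_prop)
  have hu' : Measurable (fun q : Space d × Space d => u (q.2 + ε • q.1) - u q.2) :=
    (hu.comp (by fun_prop)).sub (hu.comp (by fun_prop))
  have hv' : Measurable (fun q : Space d × Space d => v (q.2 + ε • q.1) - v q.2) :=
    (hv.comp (by fun_prop)).sub (hv.comp (by fun_prop))
  have h1 := RCLike.measurable_ofReal (𝕜 := 𝕜).comp_aemeasurable (ha.mul hp.aemeasurable)
  have h2 : Measurable (fun q : Space d × Space d =>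
      starRingEnd 𝕜 (u (q.2 + ε • q.1) - u q.2)) := RCLike.continuous_conj.measurable.comp hu'
  exact (h1.mul (h2.mul hv').aemeasurable).aestronglyMeasurable

theorem lintegral_formIntegrand_le (ε : ℝ) {u v : Space d → 𝕜} (hu : Measurable u)
    (hv : Measurable v) {C : ℝ≥0} (hC : ∀ x y, |M.p x y| ≤ C) (ξ : Space d) :
    ∫⁻ x, ‖M.formIntegrand ε u v ξ x‖ₑ ≤
      ‖M.a ξ‖ₑ * (C * (2 * eLpNorm u 2 volume) * (2 * eLpNorm v 2 volume)) := by
  have h1 : ∀ x, ‖M.formIntegrand ε u v ξ x‖ₑ ≤ ‖M.a ξ‖ₑ *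
      (C * ‖starRingEnd 𝕜 (u (x + ε • ξ) - u x) * (v (x + ε • ξ) - v x)‖ₑ) := by
    intro x
    rw [formIntegrand, enorm_mul, RCLike.ofReal_mul, enorm_mul, mul_assoc]
    have e : ∀ r : ℝ, ‖(r : 𝕜)‖ₑ = ‖r‖ₑ := fun r => by
      rw [← ofReal_norm, ← ofReal_norm, RCLike.norm_ofReal, Real.norm_eq_abs]
    rw [e, e]
    gcongr
    rw [← ofReal_norm, Real.norm_eq_abs, ← ENNReal.ofReal_coe_nnreal]
    exact ENNReal.ofReal_le_ofReal (hC _ _)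
  have hU : Measurable (fun x => u (x + ε • ξ) - u x) :=
    (hu.comp (measurable_add_const _)).sub hu
  have hV : Measurable (fun x => v (x + ε • ξ) - v x) :=
    (hv.comp (measurable_add_const _)).sub hv
  have h2 := eLpNorm_le_eLpNorm_mul_eLpNorm_of_nnnorm (μ := (volume : Measure (Space d)))
    (p := 2) (q := 2) (r := 1) hU.aestronglyMeasurable hV.aestronglyMeasurable
    (fun s t : 𝕜 => starRingEnd 𝕜 s * t) 1 (Eventually.of_forall fun x => by
      rw [nnnorm_mul, RCLike.nnnorm_conj, one_mul])
  rw [eLpNorm_one_eq_lintegral_enorm, ENNReal.coe_one, one_mul] at h2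
  calc ∫⁻ x, ‖M.formIntegrand ε u v ξ x‖ₑ
      ≤ ∫⁻ x, ‖M.a ξ‖ₑ *
        (C * ‖starRingEnd 𝕜 (u (x + ε • ξ) - u x) * (v (x + ε • ξ) - v x)‖ₑ) :=
        lintegral_mono h1
    _ = ‖M.a ξ‖ₑ * (C *
        ∫⁻ x, ‖starRingEnd 𝕜 (u (x + ε • ξ) - u x) * (v (x + ε • ξ) - v x)‖ₑ) := by
        rw [lintegral_const_mul' _ _ enorm_ne_top, lintegral_const_mul' _ _ ENNReal.coe_ne_top]
    _ ≤ ‖M.a ξ‖ₑ * (C * ((2 * eLpNorm u 2 volume) * (2 * eLpNorm v 2 volume))) := by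
        gcongr
        exact h2.trans (mul_le_mul' (eLpNorm_diff_le hu _) (eLpNorm_diff_le hv _))
    _ = _ := by ring

theorem lintegral_lintegral_formIntegrand_le (ε : ℝ) {u v : Space d → 𝕜} (hu : Measurable u)
    (hv : Measurable v) {C : ℝ≥0} (hC : ∀ x y, |M.p x y| ≤ C) :
    ∫⁻ ξ, ∫⁻ x, ‖M.formIntegrand ε u v ξ x‖ₑ ≤
      (∫⁻ ξ, ‖M.a ξ‖ₑ) * (C * (2 * eLpNorm u 2 volume) * (2 * eLpNorm v 2 volume)) := by
  refine (lintegral_mono (M.lintegral_formIntegrand_le ε hu hv hC)).trans_eq ?_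
  exact lintegral_mul_const'' _ M.integrable_a.aestronglyMeasurable.enorm

theorem integrable_formIntegrand (ε : ℝ) {u v : Space d → 𝕜} (hu : Measurable u)
    (hv : Measurable v) (hu2 : MemLp u 2 volume) (hv2 : MemLp v 2 volume) :
    Integrable (Function.uncurry (M.formIntegrand ε u v))
      ((volume : Measure (Space d)).prod volume) := by
  obtain ⟨C, hC⟩ := M.exists_p_le
  have hm := M.aestronglyMeasurable_formIntegrand ε hu hv
  refine ⟨hm, ?_⟩
  rw [HasFiniteIntegral, lintegral_prod _ hm.enorm]
  refine (M.lintegral_lintegral_formIntegrand_le ε hu hv hC).trans_lt ?_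
  have h1 : ∫⁻ ξ, ‖M.a ξ‖ₑ < ∞ := M.integrable_a.2
  have h2 := hu2.2
  have h3 := hv2.2
  finiteness

theorem softForm_congr (ε : ℝ) {u u' v v' : Space d → 𝕜} (hu : u =ᵐ[volume] u')
    (hv : v =ᵐ[volume] v') : M.softForm ε u v = M.softForm ε u' v' := by
  refine integral_congr_ae (Eventually.of_forall fun ξ => integral_congr_ae ?_)
  have hq := (measurePreserving_add_right (volume : Measure (Space d))
    (ε • ξ)).quasiMeasurePreserving
  filter_upwards [hu, hv, hq.ae_eq hu, hq.ae_eq hv] with x h1 h2 h3 h4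
  simp only [Function.comp_apply] at h3 h4
  simp only [formIntegrand, h1, h2, h3, h4]

theorem softForm_add_right (ε : ℝ) {u v v' : Space d → 𝕜} (hu : Measurable u)
    (hv : Measurable v) (hv' : Measurable v') (hu2 : MemLp u 2 volume) (hv2 : MemLp v 2 volume)
    (hv2' : MemLp v' 2 volume) :
    M.softForm ε u (v + v') = M.softForm ε u v + M.softForm ε u v' := by
  have h1 := M.integrable_formIntegrand ε hu hv hu2 hv2
  have h2 := M.integrable_formIntegrand ε hu hv' hu2 hv2'
  have h3 := integral_integral_add' h1 h2
  refine Eq.trans ?_ h3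
  rw [softForm]
  congr 1; ext ξ; congr 1; ext x
  simp only [formIntegrand, Pi.add_apply, Function.uncurry_apply_pair]
  ring

theorem softForm_smul_right (ε : ℝ) (c : 𝕜) (u v : Space d → 𝕜) :
    M.softForm ε u (c • v) = c * M.softForm ε u v := by
  rw [softForm, softForm, ← integral_const_mul]
  congr 1; ext ξ
  rw [← integral_const_mul]
  congr 1; ext x
  simp only [formIntegrand, Pi.smul_apply, smul_eq_mul]
  ring

theorem softForm_conj_symm (ε : ℝ) (u v : Space d → 𝕜) :
    M.softForm ε v u = starRingEnd 𝕜 (M.softForm ε u v) := by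
  rw [softForm, softForm, ← integral_conj]
  congr 1; ext ξ
  rw [← integral_conj]
  congr 1; ext x
  simp only [formIntegrand, map_mul, RCLike.conj_ofReal, RCLike.conj_conj]
  ring

theorem exists_norm_softForm_le (ε : ℝ) : ∃ K : ℝ,
    ∀ f g : Lp 𝕜 2 (volume : Measure (Space d)), ‖M.softForm ε f g‖ ≤ K * ‖f‖ * ‖g‖ := by
  obtain ⟨C, hC⟩ := M.exists_p_le
  refine ⟨(∫⁻ ξ, ‖M.a ξ‖ₑ).toReal * (C * 2 * 2), fun f g => ?_⟩
  have h0 : ‖M.softForm ε f g‖ₑ ≤ ∫⁻ ξ, ∫⁻ x, ‖M.formIntegrand ε f g ξ x‖ₑ :=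
    (enorm_integral_le_lintegral_enorm _).trans
      (lintegral_mono fun ξ => enorm_integral_le_lintegral_enorm _)
  have h1 := h0.trans (M.lintegral_lintegral_formIntegrand_le ε
    (Lp.stronglyMeasurable f).measurable (Lp.stronglyMeasurable g).measurable hC)
  have hA : ∫⁻ ξ, ‖M.a ξ‖ₑ ≠ ∞ := M.integrable_a.2.ne
  have hf := Lp.eLpNorm_ne_top f
  have hg := Lp.eLpNorm_ne_top g
  have h2 := ENNReal.toReal_mono (by finiteness) h1
  rw [toReal_enorm] at h2
  refine h2.trans_eq ?_
  simp only [ENNReal.toReal_mul, Lp.norm_def, ENNReal.coe_toReal, ENNReal.toReal_ofNat]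
  ring

variable (𝕜) in
/-- The form of the soft component on `L²(E)`, as a bounded sesquilinear form. -/
noncomputable def softFormCLM (ε : ℝ) (E : Set (Space d)) :
    L2On 𝕜 E →L⋆[𝕜] L2On 𝕜 E →L[𝕜] 𝕜 :=
  LinearMap.mkContinuous₂
    (LinearMap.mk₂'ₛₗ (starRingEnd 𝕜) (RingHom.id 𝕜)
      (fun f g : L2On 𝕜 E => M.softForm ε (f : Lp 𝕜 2 (volume : Measure (Space d)))
        (g : Lp 𝕜 2 (volume : Measure (Space d))))
      (by
        intro f f' g
        rw [M.softForm_conj_symm ε (g : Lp 𝕜 2 (volume : Measure (Space d))),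
          M.softForm_conj_symm ε (g : Lp 𝕜 2 (volume : Measure (Space d)))
            (f : Lp 𝕜 2 (volume : Measure (Space d))),
          M.softForm_conj_symm ε (g : Lp 𝕜 2 (volume : Measure (Space d)))
            (f' : Lp 𝕜 2 (volume : Measure (Space d))),
          ← map_add, ← M.softForm_add_right ε (Lp.stronglyMeasurable _).measurable
          (Lp.stronglyMeasurable _).measurable (Lp.stronglyMeasurable _).measurable
          (Lp.memLp _) (Lp.memLp _) (Lp.memLp _)]
        exact congrArg _ (M.softForm_congr ε EventuallyEq.rfl (Lp.coeFn_add _ _)))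
      (by
        intro c f g
        rw [M.softForm_conj_symm ε (g : Lp 𝕜 2 (volume : Measure (Space d))),
          M.softForm_conj_symm ε (g : Lp 𝕜 2 (volume : Measure (Space d)))
            (f : Lp 𝕜 2 (volume : Measure (Space d))), smul_eq_mul, ← map_mul,
          ← M.softForm_smul_right]
        exact congrArg _ (M.softForm_congr ε EventuallyEq.rfl (Lp.coeFn_smul _ _)))
      (by
        intro f g g'
        rw [← M.softForm_add_right ε (Lp.stronglyMeasurable _).measurable
          (Lp.stronglyMeasurable _).measurable (Lp.stronglyMeasurable _).measurable
          (Lp.memLp _) (Lp.memLp _) (Lp.memLp _)]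
        exact M.softForm_congr ε EventuallyEq.rfl (Lp.coeFn_add _ _))
      (by
        intro c f g
        simp only [RingHom.id_apply, smul_eq_mul]
        rw [← M.softForm_smul_right]
        exact M.softForm_congr ε EventuallyEq.rfl (Lp.coeFn_smul _ _)))
    (M.exists_norm_softForm_le (𝕜 := 𝕜) ε).choose
    (fun f g => (M.exists_norm_softForm_le (𝕜 := 𝕜) ε).choose_spec f g)

variable (𝕜) in
/-- The operator `A_{ε,soft}` on `L²(ε Y_soft ∩ S)`: the bounded operator associated with the form
`a_{ε,soft}`, i.e. `⟪A z, b⟫ = a_{ε,soft}(z, b)` for all `z, b ∈ L²(ε Y_soft ∩ S)`. -/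
noncomputable def softOperator (S : Set (Space d)) (ε : ℝ) :
    L2On 𝕜 (M.softPart S ε) →L[𝕜] L2On 𝕜 (M.softPart S ε) :=
  InnerProductSpace.continuousLinearMapOfBilin (M.softFormCLM 𝕜 ε (M.softPart S ε))

theorem inner_softOperator (S : Set (Space d)) (ε : ℝ) (z b : L2On 𝕜 (M.softPart S ε)) :
    inner 𝕜 (M.softOperator 𝕜 S ε z) b =
      M.softForm ε (z : Lp 𝕜 2 (volume : Measure (Space d)))
        (b : Lp 𝕜 2 (volume : Measure (Space d))) :=
  InnerProductSpace.continuousLinearMapOfBilin_apply _ z b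

end Form

section Vertex

variable {𝕜 : Type*} [RCLike 𝕜]

/-- The function `m(y) = 2 ∫ a(ξ) p(y, y+ξ) dξ`. -/
noncomputable def m (y : Space d) : ℝ := 2 * ∫ ξ, M.a ξ * M.p y (y + ξ)

/-- The nonlocal part `y ↦ 2 ∫ a(ξ) p(y, y+ξ) z(y+ξ) dξ` of the soft operators. -/
noncomputable def hop (z : Space d → 𝕜) (y : Space d) : 𝕜 :=
  2 * ∫ ξ, ((M.a ξ * M.p y (y + ξ) : ℝ) : 𝕜) * z (y + ξ)

/-- The soft component in the orthant attached to the vertex `σ`. -/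
def vertexPart (σ : Fin d → Bool) : Set (Space d) := orthant σ ∩ M.soft

theorem measurableSet_vertexPart (σ : Fin d → Bool) : MeasurableSet (M.vertexPart σ) :=
  (measurableSet_orthant σ).inter M.isOpen_soft.measurableSet

/-- The function `m z - 1_E 2 ∫ a(ξ) p(·, ·+ξ) z(·+ξ) dξ`, for `E` the soft component in an
orthant. -/
noncomputable def vertexFun (σ : Fin d → Bool) (z : Space d → 𝕜) (y : Space d) : 𝕜 :=
  (M.m y : 𝕜) * z y - (M.vertexPart σ).indicator (M.hop z) y

theorem aestronglyMeasurable_kernel :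
    AEStronglyMeasurable (fun q : Space d × Space d => M.a q.2 * M.p q.1 (q.1 + q.2))
      ((volume : Measure (Space d)).prod volume) := by
  have ha : AEMeasurable (fun q : Space d × Space d => M.a q.2)
      ((volume : Measure (Space d)).prod volume) :=
    M.integrable_a.aestronglyMeasurable.aemeasurable.comp_quasiMeasurePreserving
      Measure.quasiMeasurePreserving_snd
  have hp : Measurable (fun q : Space d × Space d => M.p q.1 (q.1 + q.2)) :=
    M.measurable_p.comp (f := fun q : Space d × Space d => (q.1, q.1 + q.2)) (by fun_prop)
  exact (ha.mul hp.aemeasurable).aestronglyMeasurable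

theorem aestronglyMeasurable_m : AEStronglyMeasurable M.m volume :=
  (M.aestronglyMeasurable_kernel.integral_prod_right').const_mul 2

theorem aestronglyMeasurable_hop_integrand {z : Space d → 𝕜} (hz : Measurable z) :
    AEStronglyMeasurable (fun q : Space d × Space d =>
      ((M.a q.2 * M.p q.1 (q.1 + q.2) : ℝ) : 𝕜) * z (q.1 + q.2))
      ((volume : Measure (Space d)).prod volume) := by
  have h1 := RCLike.measurable_ofReal (𝕜 := 𝕜).comp_aemeasurable
    M.aestronglyMeasurable_kernel.aemeasurable
  have h2 : Measurable (fun q : Space d × Space d => z (q.1 + q.2)) := hz.comp (by fun_prop)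
  exact (h1.mul h2.aemeasurable).aestronglyMeasurable

theorem aestronglyMeasurable_hop {z : Space d → 𝕜} (hz : Measurable z) :
    AEStronglyMeasurable (M.hop z) volume :=
  ((M.aestronglyMeasurable_hop_integrand hz).integral_prod_right').const_mul 2

theorem exists_abs_m_le : ∃ K : ℝ, ∀ y, |M.m y| ≤ K := by
  obtain ⟨C, hC⟩ := M.exists_p_le
  refine ⟨2 * ∫ ξ, M.a ξ * C, fun y => ?_⟩
  rw [m, abs_mul, abs_two]
  gcongr
  change ‖∫ ξ, M.a ξ * M.p y (y + ξ)‖ ≤ _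
  refine norm_integral_le_of_norm_le (M.integrable_a.mul_const _) (Eventually.of_forall fun ξ => ?_)
  rw [Real.norm_eq_abs, abs_mul, abs_of_nonneg (M.a_nonneg ξ)]
  exact mul_le_mul_of_nonneg_left (hC _ _) (M.a_nonneg ξ)

theorem lintegral_sq_le {z : Space d → 𝕜} (hz : Measurable z) :
    ∫⁻ y, (∫⁻ ξ, ‖M.a ξ‖ₑ * ‖z (y + ξ)‖ₑ) ^ (2 : ℝ) ≤
      (∫⁻ ξ, ‖M.a ξ‖ₑ) ^ (2 : ℝ) * ∫⁻ y, ‖z y‖ₑ ^ (2 : ℝ) := by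
  have ha : AEMeasurable (fun ξ => ‖M.a ξ‖ₑ) volume := M.integrable_a.aestronglyMeasurable.enorm
  have hpow : ∀ t : ℝ≥0∞, (t ^ (1 / 2 : ℝ)) ^ (2 : ℝ) = t := fun t => by
    rw [← ENNReal.rpow_mul]; norm_num
  have h1 : ∀ y, (∫⁻ ξ, ‖M.a ξ‖ₑ * ‖z (y + ξ)‖ₑ) ^ (2 : ℝ) ≤
      (∫⁻ ξ, ‖M.a ξ‖ₑ) * ∫⁻ ξ, ‖M.a ξ‖ₑ * ‖z (y + ξ)‖ₑ ^ (2 : ℝ) := by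
    intro y
    have hzy : Measurable (fun ξ => ‖z (y + ξ)‖ₑ) := (hz.comp (by fun_prop)).enorm
    have h := ENNReal.lintegral_mul_le_Lp_mul_Lq (volume : Measure (Space d))
      Real.HolderConjugate.two_two (ha.pow_const (1 / 2 : ℝ))
      ((ha.pow_const (1 / 2 : ℝ)).mul hzy.aemeasurable)
    simp only [Pi.mul_apply, ENNReal.mul_rpow_of_nonneg _ _ (by norm_num : (0 : ℝ) ≤ 2),
      hpow] at h
    have h' := ENNReal.rpow_le_rpow h (by norm_num : (0 : ℝ) ≤ 2)
    rw [ENNReal.mul_rpow_of_nonneg _ _ (by norm_num : (0 : ℝ) ≤ 2), hpow, hpow] at h'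
    refine le_trans (le_of_eq ?_) h'
    congr 2; ext ξ
    rw [← mul_assoc, ← ENNReal.rpow_add_of_nonneg _ _ (by norm_num) (by norm_num)]
    norm_num
  have hF : AEMeasurable (Function.uncurry fun y ξ : Space d =>
      ‖M.a ξ‖ₑ * ‖z (y + ξ)‖ₑ ^ (2 : ℝ)) ((volume : Measure (Space d)).prod volume) := by
    have hz' : Measurable (fun q : Space d × Space d => ‖z (q.1 + q.2)‖ₑ ^ (2 : ℝ)) :=
      (hz.comp (by fun_prop : Measurable fun q : Space d × Space d => q.1 + q.2)).enorm.pow_const _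
    exact (ha.comp_quasiMeasurePreserving Measure.quasiMeasurePreserving_snd).mul hz'.aemeasurable
  calc ∫⁻ y, (∫⁻ ξ, ‖M.a ξ‖ₑ * ‖z (y + ξ)‖ₑ) ^ (2 : ℝ)
      ≤ ∫⁻ y, (∫⁻ ξ, ‖M.a ξ‖ₑ) * ∫⁻ ξ, ‖M.a ξ‖ₑ * ‖z (y + ξ)‖ₑ ^ (2 : ℝ) := lintegral_mono h1
    _ = (∫⁻ ξ, ‖M.a ξ‖ₑ) * ∫⁻ y, ∫⁻ ξ, ‖M.a ξ‖ₑ * ‖z (y + ξ)‖ₑ ^ (2 : ℝ) :=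
        lintegral_const_mul' _ _ M.integrable_a.2.ne
    _ = (∫⁻ ξ, ‖M.a ξ‖ₑ) * ∫⁻ ξ, ∫⁻ y, ‖M.a ξ‖ₑ * ‖z (y + ξ)‖ₑ ^ (2 : ℝ) := by
        rw [lintegral_lintegral_swap hF]
    _ = (∫⁻ ξ, ‖M.a ξ‖ₑ) * ∫⁻ ξ, ‖M.a ξ‖ₑ * ∫⁻ y, ‖z y‖ₑ ^ (2 : ℝ) := by
        congr 1
        refine lintegral_congr fun ξ => ?_
        rw [lintegral_const_mul' _ _ enorm_ne_top]
        congr 1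
        exact lintegral_add_right_eq_self (fun y => ‖z y‖ₑ ^ (2 : ℝ)) ξ
    _ = _ := by
        rw [lintegral_mul_const'' _ ha, ENNReal.rpow_two]
        ring

theorem enorm_hop_integrand_le {C : ℝ≥0} (hC : ∀ x y, |M.p x y| ≤ C) (z : Space d → 𝕜)
    (y ξ : Space d) : ‖((M.a ξ * M.p y (y + ξ) : ℝ) : 𝕜) * z (y + ξ)‖ₑ ≤
      C * (‖M.a ξ‖ₑ * ‖z (y + ξ)‖ₑ) := by
  have e : ∀ r : ℝ, ‖(r : 𝕜)‖ₑ = ‖r‖ₑ := fun r => by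
    rw [← ofReal_norm, ← ofReal_norm, RCLike.norm_ofReal, Real.norm_eq_abs]
  rw [enorm_mul, e, enorm_mul, mul_comm ‖M.a ξ‖ₑ, mul_assoc]
  gcongr
  rw [← ofReal_norm, Real.norm_eq_abs, ← ENNReal.ofReal_coe_nnreal]
  exact ENNReal.ofReal_le_ofReal (hC _ _)

theorem eLpNorm_hop_le {C : ℝ≥0} (hC : ∀ x y, |M.p x y| ≤ C) {z : Space d → 𝕜}
    (hz : Measurable z) :
    eLpNorm (M.hop z) 2 volume ≤ (2 * C * ∫⁻ ξ, ‖M.a ξ‖ₑ) * eLpNorm z 2 volume := by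
  have h1 : ∀ y, ‖M.hop z y‖ₑ ≤ 2 * C * ∫⁻ ξ, ‖M.a ξ‖ₑ * ‖z (y + ξ)‖ₑ := by
    intro y
    rw [hop, enorm_mul, mul_assoc]
    gcongr
    · rw [← ofReal_norm, RCLike.norm_ofNat]; simp
    · refine (enorm_integral_le_lintegral_enorm _).trans ?_
      rw [← lintegral_const_mul' _ _ ENNReal.coe_ne_top]
      exact lintegral_mono fun ξ => M.enorm_hop_integrand_le hC z y ξ
  have h2 : ∫⁻ y, ‖M.hop z y‖ₑ ^ (2 : ℝ) ≤
      (2 * C * ∫⁻ ξ, ‖M.a ξ‖ₑ) ^ (2 : ℝ) * ∫⁻ y, ‖z y‖ₑ ^ (2 : ℝ) := by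
    calc ∫⁻ y, ‖M.hop z y‖ₑ ^ (2 : ℝ)
        ≤ ∫⁻ y, (2 * C) ^ (2 : ℝ) * (∫⁻ ξ, ‖M.a ξ‖ₑ * ‖z (y + ξ)‖ₑ) ^ (2 : ℝ) := by
          refine lintegral_mono fun y => ?_
          rw [← ENNReal.mul_rpow_of_nonneg _ _ (by norm_num : (0 : ℝ) ≤ 2)]
          exact ENNReal.rpow_le_rpow (h1 y) (by norm_num)
      _ = (2 * C) ^ (2 : ℝ) * ∫⁻ y, (∫⁻ ξ, ‖M.a ξ‖ₑ * ‖z (y + ξ)‖ₑ) ^ (2 : ℝ) := by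
          refine lintegral_const_mul' _ _ ?_
          finiteness
      _ ≤ _ := by
          rw [ENNReal.mul_rpow_of_nonneg (2 * C : ℝ≥0∞) _ (by norm_num : (0 : ℝ) ≤ 2), mul_assoc]
          gcongr
          exact M.lintegral_sq_le hz
  have h3 := ENNReal.rpow_le_rpow h2 (by norm_num : (0 : ℝ) ≤ 1 / 2)
  rw [ENNReal.mul_rpow_of_nonneg _ _ (by norm_num : (0 : ℝ) ≤ 1 / 2), ← ENNReal.rpow_mul] at h3
  rw [eLpNorm_eq_lintegral_rpow_enorm_toReal (by norm_num) (by norm_num),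
    eLpNorm_eq_lintegral_rpow_enorm_toReal (by norm_num) (by norm_num)]
  simpa using h3

theorem ae_integrable_hop {z : Space d → 𝕜} (hz : Measurable z) (hz2 : MemLp z 2 volume) :
    ∀ᵐ y, Integrable (fun ξ => ((M.a ξ * M.p y (y + ξ) : ℝ) : 𝕜) * z (y + ξ)) volume := by
  obtain ⟨C, hC⟩ := M.exists_p_le
  have h1 := M.lintegral_sq_le hz
  have hz3 : ∫⁻ y, ‖z y‖ₑ ^ (2 : ℝ) < ∞ := by
    have := lintegral_rpow_enorm_lt_top_of_eLpNorm_lt_top (by norm_num) (by norm_num) hz2.2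
    simpa using this
  have hA : ∫⁻ ξ, ‖M.a ξ‖ₑ < ∞ := M.integrable_a.2
  have hF : AEMeasurable (fun y => (∫⁻ ξ, ‖M.a ξ‖ₑ * ‖z (y + ξ)‖ₑ) ^ (2 : ℝ)) volume := by
    have hz' : Measurable (fun q : Space d × Space d => ‖z (q.1 + q.2)‖ₑ) :=
      (hz.comp (by fun_prop : Measurable fun q : Space d × Space d => q.1 + q.2)).enorm
    have ha : AEMeasurable (fun ξ => ‖M.a ξ‖ₑ) volume := M.integrable_a.aestronglyMeasurable.enorm
    exact (((ha.comp_quasiMeasurePreserving Measure.quasiMeasurePreserving_snd).mul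
      hz'.aemeasurable).lintegral_prod_right').pow_const _
  have h2 := ae_lt_top' hF (h1.trans_lt (by finiteness)).ne
  filter_upwards [h2, (M.aestronglyMeasurable_hop_integrand hz).prodMk_left] with y hy hm
  refine ⟨hm, ?_⟩
  have hy' : ∫⁻ ξ, ‖M.a ξ‖ₑ * ‖z (y + ξ)‖ₑ < ∞ := by
    by_contra hcon
    rw [not_lt, top_le_iff] at hcon
    rw [hcon] at hy
    simp at hy
  refine (lintegral_mono fun ξ => M.enorm_hop_integrand_le hC z y ξ).trans_lt ?_
  rw [lintegral_const_mul' _ _ ENNReal.coe_ne_top]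
  finiteness

theorem exists_memLp_vertexFun (σ : Fin d → Bool) : ∃ K : ℝ, 0 ≤ K ∧
    ∀ f : Lp 𝕜 2 (volume : Measure (Space d)), MemLp (M.vertexFun σ f) 2 volume ∧
      (eLpNorm (M.vertexFun σ f) 2 volume).toReal ≤ K * ‖f‖ := by
  obtain ⟨C, hC⟩ := M.exists_p_le
  obtain ⟨B, hB⟩ := M.exists_abs_m_le
  have hB0 : 0 ≤ B := (abs_nonneg _).trans (hB 0)
  have hA : ∫⁻ ξ, ‖M.a ξ‖ₑ < ∞ := M.integrable_a.2
  refine ⟨B + (2 * C * ∫⁻ ξ, ‖M.a ξ‖ₑ).toReal, by positivity, fun f => ?_⟩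
  have hf := (Lp.stronglyMeasurable f).measurable
  have h1m : AEStronglyMeasurable (fun y => (M.m y : 𝕜) * f y) volume :=
    (RCLike.continuous_ofReal.comp_aestronglyMeasurable M.aestronglyMeasurable_m).mul
      hf.aestronglyMeasurable
  have h1 : eLpNorm (fun y => (M.m y : 𝕜) * f y) 2 volume ≤
      ENNReal.ofReal B * eLpNorm f 2 volume := by
    refine eLpNorm_le_mul_eLpNorm_of_ae_le_mul (Eventually.of_forall fun y => ?_) 2
    rw [norm_mul, RCLike.norm_ofReal]
    exact mul_le_mul_of_nonneg_right (hB y) (norm_nonneg _)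
  have h2m : AEStronglyMeasurable ((M.vertexPart σ).indicator (M.hop f)) volume :=
    (M.aestronglyMeasurable_hop hf).indicator (M.measurableSet_vertexPart σ)
  have h2 := (eLpNorm_indicator_le (s := M.vertexPart σ) (M.hop f) (p := 2)
    (μ := (volume : Measure (Space d)))).trans (M.eLpNorm_hop_le hC hf)
  have h3 : eLpNorm (M.vertexFun σ f) 2 volume ≤
      (ENNReal.ofReal B + 2 * C * ∫⁻ ξ, ‖M.a ξ‖ₑ) * eLpNorm f 2 volume := by
    rw [add_mul]
    exact (eLpNorm_sub_le h1m h2m (by norm_num)).trans (add_le_add h1 h2)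
  have hft := Lp.eLpNorm_ne_top f
  refine ⟨⟨h1m.sub h2m, h3.trans_lt (by finiteness)⟩, ?_⟩
  have h4 := ENNReal.toReal_mono (by finiteness) h3
  rwa [ENNReal.toReal_mul, ENNReal.toReal_add (by finiteness) (by finiteness),
    ENNReal.toReal_ofReal hB0, ← Lp.norm_def] at h4

theorem memLp_vertexFun (σ : Fin d → Bool) (f : Lp 𝕜 2 (volume : Measure (Space d))) :
    MemLp (M.vertexFun σ f) 2 volume := by
  obtain ⟨K, -, hK⟩ := M.exists_memLp_vertexFun (𝕜 := 𝕜) σ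
  exact (hK f).1

theorem hop_congr {z z' : Space d → 𝕜} (h : z =ᵐ[volume] z') : M.hop z = M.hop z' := by
  ext y
  rw [hop, hop]
  congr 1
  refine integral_congr_ae ?_
  filter_upwards [(measurePreserving_add_left (volume : Measure (Space d))
    y).quasiMeasurePreserving.ae_eq h] with ξ hξ
  simp only [Function.comp_apply] at hξ
  rw [hξ]

theorem vertexFun_congr (σ : Fin d → Bool) {z z' : Space d → 𝕜} (h : z =ᵐ[volume] z') :
    M.vertexFun σ z =ᵐ[volume] M.vertexFun σ z' := by
  filter_upwards [h] with y hy
  rw [vertexFun, vertexFun, M.hop_congr h, hy]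

theorem vertexFun_add (σ : Fin d → Bool) (f g : Lp 𝕜 2 (volume : Measure (Space d))) :
    M.vertexFun σ (f + g : Lp 𝕜 2 (volume : Measure (Space d))) =ᵐ[volume]
      M.vertexFun σ f + M.vertexFun σ g := by
  refine (M.vertexFun_congr σ (Lp.coeFn_add f g)).trans ?_
  filter_upwards [M.ae_integrable_hop (Lp.stronglyMeasurable f).measurable (Lp.memLp f),
    M.ae_integrable_hop (Lp.stronglyMeasurable g).measurable (Lp.memLp g)] with y h1 h2
  have h3 : M.hop (f + g : Space d → 𝕜) y = M.hop f y + M.hop g y := by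
    simp only [hop, Pi.add_apply, mul_add]
    rw [integral_add h1 h2, mul_add]
  by_cases hy : y ∈ M.vertexPart σ
  · simp only [vertexFun, Set.indicator_of_mem hy, h3, Pi.add_apply]
    ring
  · simp only [vertexFun, Set.indicator_of_notMem hy, Pi.add_apply]
    ring

theorem vertexFun_smul (σ : Fin d → Bool) (c : 𝕜) (f : Lp 𝕜 2 (volume : Measure (Space d))) :
    M.vertexFun σ (c • f : Lp 𝕜 2 (volume : Measure (Space d))) =ᵐ[volume]
      c • M.vertexFun σ f := by
  refine (M.vertexFun_congr σ (Lp.coeFn_smul c f)).trans (Eventually.of_forall fun y => ?_)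
  have h3 : M.hop (c • f : Space d → 𝕜) y = c * M.hop f y := by
    simp only [hop, Pi.smul_apply, smul_eq_mul]
    rw [mul_left_comm c, ← integral_const_mul (r := c)]
    congr 2
    funext ξ
    exact mul_left_comm _ _ _
  by_cases hy : y ∈ M.vertexPart σ
  · simp only [vertexFun, Set.indicator_of_mem hy, h3, Pi.smul_apply, smul_eq_mul]
    ring
  · simp only [vertexFun, Set.indicator_of_notMem hy, Pi.smul_apply, smul_eq_mul]
    ring

/-- The function `vertexFun σ f`, as an element of `L²(ℝ^d)`. -/
noncomputable def vertexLp (σ : Fin d → Bool) (f : Lp 𝕜 2 (volume : Measure (Space d))) :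
    Lp 𝕜 2 (volume : Measure (Space d)) :=
  (M.memLp_vertexFun σ f).toLp (M.vertexFun σ f)

theorem coeFn_vertexLp (σ : Fin d → Bool) (f : Lp 𝕜 2 (volume : Measure (Space d))) :
    M.vertexLp σ f =ᵐ[volume] M.vertexFun σ f :=
  (M.memLp_vertexFun σ f).coeFn_toLp

theorem vertexLp_add (σ : Fin d → Bool) (f g : Lp 𝕜 2 (volume : Measure (Space d))) :
    M.vertexLp σ (f + g) = M.vertexLp σ f + M.vertexLp σ g := by
  apply Lp.ext
  filter_upwards [M.coeFn_vertexLp σ (f + g), M.coeFn_vertexLp σ f, M.coeFn_vertexLp σ g,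
    M.vertexFun_add σ f g, Lp.coeFn_add (M.vertexLp σ f) (M.vertexLp σ g)] with x h1 h2 h3 h4 h5
  rw [h1, h4, h5, Pi.add_apply, Pi.add_apply, h2, h3]

theorem vertexLp_smul (σ : Fin d → Bool) (c : 𝕜) (f : Lp 𝕜 2 (volume : Measure (Space d))) :
    M.vertexLp σ (c • f) = c • M.vertexLp σ f := by
  apply Lp.ext
  filter_upwards [M.coeFn_vertexLp σ (c • f), M.coeFn_vertexLp σ f, M.vertexFun_smul σ c f,
    Lp.coeFn_smul c (M.vertexLp σ f)] with x h1 h2 h4 h5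
  rw [h1, h4, h5, Pi.smul_apply, Pi.smul_apply, h2]

variable (𝕜) in
theorem exists_norm_vertexLp_le (σ : Fin d → Bool) : ∃ K : ℝ,
    ∀ f : Lp 𝕜 2 (volume : Measure (Space d)), ‖M.vertexLp σ f‖ ≤ K * ‖f‖ := by
  obtain ⟨K, -, hK⟩ := M.exists_memLp_vertexFun (𝕜 := 𝕜) σ
  refine ⟨K, fun f => ?_⟩
  rw [vertexLp, Lp.norm_toLp]
  exact (hK f).2

theorem vertexLp_mem (σ : Fin d → Bool) (f : L2On 𝕜 (M.vertexPart σ)) :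
    M.vertexLp σ (f : Lp 𝕜 2 (volume : Measure (Space d))) ∈ L2On 𝕜 (M.vertexPart σ) := by
  have hf : ∀ᵐ x, x ∉ M.vertexPart σ → (f : Lp 𝕜 2 (volume : Measure (Space d))) x = 0 := f.2
  change ∀ᵐ x, x ∉ M.vertexPart σ → _ = _
  filter_upwards [hf, M.coeFn_vertexLp σ (f : Lp 𝕜 2 (volume : Measure (Space d)))] with x h1 h2 hx
  rw [h2, vertexFun, h1 hx, Set.indicator_of_notMem hx, mul_zero, sub_zero]

variable (𝕜) in
/-- The vertex operator on `L²` of the soft component `E` in the orthant attached to the vertex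
`σ`: `z ↦ m z - 1_E 2 ∫ a(ξ) p(·, ·+ξ) z(·+ξ) dξ`. -/
noncomputable def vertexOperator (σ : Fin d → Bool) :
    L2On 𝕜 (M.vertexPart σ) →L[𝕜] L2On 𝕜 (M.vertexPart σ) :=
  LinearMap.mkContinuousOfExistsBound
    { toFun := fun f =>
        ⟨M.vertexLp σ (f : Lp 𝕜 2 (volume : Measure (Space d))), M.vertexLp_mem σ f⟩
      map_add' := fun _ _ => Subtype.ext (M.vertexLp_add σ _ _)
      map_smul' := fun c _ => Subtype.ext (M.vertexLp_smul σ c _) }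
    ((M.exists_norm_vertexLp_le 𝕜 σ).imp fun _ hK f =>
      hK (f : Lp 𝕜 2 (volume : Measure (Space d))))

theorem coeFn_vertexOperator (σ : Fin d → Bool) (z : L2On 𝕜 (M.vertexPart σ)) :
    ((M.vertexOperator 𝕜 σ z : L2On 𝕜 (M.vertexPart σ)) : Lp 𝕜 2 (volume : Measure (Space d)))
      =ᵐ[volume] M.vertexFun σ (z : Lp 𝕜 2 (volume : Measure (Space d))) :=
  M.coeFn_vertexLp σ _

end Vertex

end Medium

end HighContrast

/-! After the change of variables `x = ε y` every operator in the statement is a compression of one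
operator on functions on the whole space, `T = m - hop`; `resid c` is `T - c`. The form at scale one
is twice the pairing of the nonlocal difference with the test function, because `a` is even and `p`
symmetric (`softForm_one`). The soft operator therefore corresponds to `T` cut to the soft set in a
box of edges `(N + 1) * l j`, and the vertex operator to `T` cut to the soft set in an orthant.
Lattice translations commute with `T`, and the vertices of the large box are lattice points, so each
vertex can be moved to the origin.

For these bounded symmetric operators the spectrum is real and is described by approximate
eigenvectors (`exists_approx_eigenvector`, `exists_mem_spectrum_near`). Both inclusions compare
residuals.

From orthant to box: an approximate eigenfunction in an orthant may be taken with bounded support.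
Moved to the corresponding corner of a large enough box, it lives in the box. The box is contained
in the translated orthant, so the residual does not grow (`exists_approx_box`).

From box to orthants: suppose that `t` lies outside the spectra of all vertex operators, so that
each of them minus `t` is bounded below. A function `z` on the box is split by a partition of unity
with one piece per vertex, a product of hats as wide as the box. Within the translated orthant of
its vertex a cutoff vanishes outside the box. Hence there `T - t` applied to the piece is the cutoff
times the residual of `z` in the box, up to a commutator. The cutoffs have Lipschitz constant of
order `1 / N` and `a` has a finite first moment, so the commutator is small
(`exists_eLpNorm_commutator_le`). Summing over the vertices gives a lower bound uniform in the box
(`exists_eLpNorm_le_box`), which excludes spectral points converging to `t`. Faces and interior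
contribute nothing new, since the vertex pieces already cover the whole box. -/

namespace HighContrast

/-! ### Spectra of bounded symmetric operators through approximate eigenvectors. -/

section Spectral

variable {𝕜 H : Type*} [RCLike 𝕜] [NormedAddCommGroup H] [InnerProductSpace 𝕜 H]

/-- Points of the spectrum of a bounded self-adjoint operator are approximate eigenvalues. -/
theorem exists_approx_eigenvector [CompleteSpace H] {A : H →L[𝕜] H}
    (hA : ∀ x y, inner 𝕜 (A x) y = inner 𝕜 x (A y))
    {c : 𝕜} (hc : c ∈ spectrum 𝕜 A) {δ : ℝ} (hδ : 0 < δ) :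
    ∃ f : H, f ≠ 0 ∧ ‖A f - c • f‖ < δ * ‖f‖ := by
  by_contra! h
  have h' : ∀ f : H, δ * ‖f‖ ≤ ‖A f - c • f‖ := fun f => by
    rcases eq_or_ne f 0 with rfl | hf
    · simp
    · exact h f hf
  refine hc ?_
  set B : H →L[𝕜] H := algebraMap 𝕜 (H →L[𝕜] H) c - A with hB
  set B' : H →L[𝕜] H := algebraMap 𝕜 (H →L[𝕜] H) (starRingEnd 𝕜 c) - A with hB'
  have hBx : ∀ x, B x = c • x - A x := fun x => by simp [hB, Algebra.algebraMap_eq_smul_one]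
  have hBx' : ∀ x, B' x = starRingEnd 𝕜 c • x - A x := fun x => by
    simp [hB', Algebra.algebraMap_eq_smul_one]
  have hadj : ∀ x y, inner 𝕜 (B' x) y = inner 𝕜 x (B y) := fun x y => by
    rw [hBx, hBx', inner_sub_left, inner_sub_right, hA, inner_smul_left, inner_smul_right,
      RCLike.conj_conj]
  have hcomm : Commute B' B :=
    ((Algebra.commute_algebraMap_left _ _).sub_left
      ((Algebra.commute_algebraMap_right _ _).sub_right (Commute.refl A)))
  -- A lower bound for `B` makes `B' * B` coercive, since `⟪B' B x, x⟫ = ‖B x‖²`, hence invertible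
  -- by Lax–Milgram. Its commuting factors are then invertible too. The conjugate in `B'` is needed
  -- because `c` is not yet known to be real.
  have hu : IsUnit (B' * B) := by
    refine ContinuousLinearMap.isUnit_of_forall_le_norm_inner_map _ (c := ⟨δ ^ 2, by positivity⟩)
      (NNReal.coe_pos.1 (pow_pos hδ 2)) fun x => ?_
    rw [mul_apply_eq_comp, hadj, inner_self_eq_norm_sq_to_K]
    have h1 := h' x
    rw [norm_sub_rev, ← hBx] at h1
    have h2 : (δ * ‖x‖) ^ 2 ≤ ‖B x‖ ^ 2 := by gcongr
    have h3 : ‖((‖B x‖ : 𝕜)) ^ 2‖ = ‖B x‖ ^ 2 := by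
      rw [norm_pow, RCLike.norm_ofReal, abs_of_nonneg (norm_nonneg _)]
    rw [h3]
    change ‖x‖ ^ 2 * δ ^ 2 ≤ _
    linarith [mul_pow δ ‖x‖ 2]
  exact (hcomm.isUnit_mul_iff.1 hu).2

/-- The spectrum of a bounded self-adjoint operator is real. -/
theorem exists_real_of_mem_spectrum [CompleteSpace H] {A : H →L[𝕜] H}
    (hA : ∀ x y, inner 𝕜 (A x) y = inner 𝕜 x (A y))
    {c : 𝕜} (hc : c ∈ spectrum 𝕜 A) : ((RCLike.re c : ℝ) : 𝕜) = c := by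
  by_contra hne
  have him : 0 < |RCLike.im c| := by
    refine abs_pos.2 fun h0 => hne ?_
    apply RCLike.ext <;> simp [h0]
  obtain ⟨f, hf, h⟩ := exists_approx_eigenvector hA hc him
  have hre : RCLike.im (inner 𝕜 f (A f)) = 0 := by
    have h1 := hA f f
    rw [← inner_conj_symm] at h1
    have := congrArg RCLike.im h1
    rw [RCLike.conj_im] at this
    linarith
  -- Since `⟪f, A f⟫` is real, only `c` contributes to the imaginary part. Cauchy–Schwarz then
  -- contradicts the choice `δ = |im c|`.
  have h2 : RCLike.im (inner 𝕜 f (A f - c • f)) = -(RCLike.im c * ‖f‖ ^ 2) := by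
    rw [inner_sub_right, inner_smul_right, inner_self_eq_norm_sq_to_K, map_sub, hre, zero_sub,
      ← RCLike.ofReal_pow, RCLike.im_mul_ofReal]
  have h3 := (RCLike.abs_im_le_norm _).trans (norm_inner_le_norm (𝕜 := 𝕜) f (A f - c • f))
  rw [h2, abs_neg, abs_mul, abs_of_nonneg (by positivity : 0 ≤ ‖f‖ ^ 2)] at h3
  have hf' := norm_pos_iff.2 hf
  nlinarith [mul_lt_mul_of_pos_left h hf']

/-- An approximate eigenvalue of a bounded self-adjoint operator is close to the spectrum. -/
theorem exists_mem_spectrum_near {A : H →L[𝕜] H}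
    (hA : ∀ x y, inner 𝕜 (A x) y = inner 𝕜 x (A y)) (r : ℝ) {f : H} (hf : f ≠ 0) {δ : ℝ}
    (hδ : ‖A f - (r : 𝕜) • f‖ ≤ δ * ‖f‖) : ∃ c ∈ spectrum 𝕜 A, ‖c - r‖ ≤ δ := by
  set B : H →L[𝕜] H := A - algebraMap 𝕜 (H →L[𝕜] H) r with hB
  have hBx : ∀ x, B x = A x - (r : 𝕜) • x := fun x => by simp [hB, Algebra.algebraMap_eq_smul_one]
  have hBs : ∀ x y, inner 𝕜 (B x) y = inner 𝕜 x (B y) := fun x y => by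
    rw [hBx, hBx, inner_sub_left, inner_sub_right, hA, inner_smul_left, inner_smul_right,
      RCLike.conj_ofReal]
  -- The infimum `s` of these quotients is at most `δ`, and one of `r + s`, `r - s` will turn out to
  -- be a spectral point. Both are real, so the argument is the same over either scalar field.
  set Q : Set ℝ := {t | ∃ x : H, x ≠ 0 ∧ t = ‖B x‖ / ‖x‖} with hQ
  have hbdd : BddBelow Q := ⟨0, by rintro t ⟨x, -, rfl⟩; positivity⟩
  have hfQ : ‖B f‖ / ‖f‖ ∈ Q := ⟨f, hf, rfl⟩
  set s := sInf Q with hs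
  have hs0 : 0 ≤ s := Real.sInf_nonneg (by rintro t ⟨x, -, rfl⟩; positivity)
  have hsδ : s ≤ δ := (csInf_le hbdd hfQ).trans (by
    rw [div_le_iff₀ (norm_pos_iff.2 hf), hBx]; exact hδ)
  have hlow : ∀ x, s * ‖x‖ ≤ ‖B x‖ := fun x => by
    rcases eq_or_ne x 0 with rfl | hx
    · simp
    · exact (le_div_iff₀ (norm_pos_iff.2 hx)).1 (csInf_le hbdd ⟨x, hx, rfl⟩)
  set P : H →L[𝕜] H := B * B - algebraMap 𝕜 (H →L[𝕜] H) ((s ^ 2 : ℝ) : 𝕜) with hP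
  have hPx : ∀ x, P x = B (B x) - ((s ^ 2 : ℝ) : 𝕜) • x := fun x => by
    simp [hP, Algebra.algebraMap_eq_smul_one]
  have hPs : ∀ x y, inner 𝕜 (P x) y = inner 𝕜 x (P y) := fun x y => by
    rw [hPx, hPx, inner_sub_left, inner_sub_right, hBs, hBs, inner_smul_left, inner_smul_right,
      RCLike.conj_ofReal]
  have hPq : ∀ x, RCLike.re (inner 𝕜 (P x) x) = ‖B x‖ ^ 2 - s ^ 2 * ‖x‖ ^ 2 := fun x => by
    rw [hPx, inner_sub_left, hBs, inner_smul_left, RCLike.conj_ofReal, map_sub,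
      RCLike.re_ofReal_mul, inner_self_eq_norm_sq, inner_self_eq_norm_sq]
  have hP0 : ∀ x, 0 ≤ RCLike.re (inner 𝕜 (P x) x) := fun x => by
    rw [hPq, ← mul_pow, sub_nonneg]
    exact pow_le_pow_left₀ (by positivity) (hlow x) 2
  -- the Cauchy–Schwarz inequality for the form of `P`
  set K := ‖P‖ + 1 with hK
  have hK0 : 0 < K := by positivity
  have hCS : ∀ x, ‖P x‖ ^ 2 ≤ K * RCLike.re (inner 𝕜 (P x) x) := fun x => by
    -- Positivity of the form is tested at a gradient step from `x`; the step length `K⁻¹` is below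
    -- the inverse of the norm of `P`.
    have h1 := hP0 (x - ((K⁻¹ : ℝ) : 𝕜) • P x)
    have h2 : RCLike.re (inner 𝕜 (P (P x)) (P x)) ≤ K * ‖P x‖ ^ 2 := by
      refine (RCLike.re_le_norm _).trans ((norm_inner_le_norm _ _).trans ?_)
      have := P.le_opNorm (P x)
      nlinarith [norm_nonneg (P x), norm_nonneg (P (P x))]
    have h3 : RCLike.re (inner 𝕜 (P (x - ((K⁻¹ : ℝ) : 𝕜) • P x)) (x - ((K⁻¹ : ℝ) : 𝕜) • P x)) =
        RCLike.re (inner 𝕜 (P x) x) - 2 * K⁻¹ * ‖P x‖ ^ 2 +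
          K⁻¹ ^ 2 * RCLike.re (inner 𝕜 (P (P x)) (P x)) := by
      rw [map_sub, map_smul, inner_sub_left, inner_sub_right, inner_sub_right, inner_smul_left,
        inner_smul_left, inner_smul_right, inner_smul_right, RCLike.conj_ofReal, hPs (P x) x]
      simp only [map_sub, RCLike.re_ofReal_mul, inner_self_eq_norm_sq]
      ring
    rw [h3] at h1
    have h4 : K⁻¹ ^ 2 * RCLike.re (inner 𝕜 (P (P x)) (P x)) ≤ K⁻¹ * ‖P x‖ ^ 2 := by
      calc _ ≤ K⁻¹ ^ 2 * (K * ‖P x‖ ^ 2) := by gcongr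
        _ = _ := by field_simp
    have h5 : K⁻¹ * ‖P x‖ ^ 2 ≤ RCLike.re (inner 𝕜 (P x) x) := by linarith
    rwa [inv_mul_le_iff₀ hK0] at h5
  -- The form of `P = B² - s²` has infimum zero on unit vectors. By the inequality `hCS`, `‖P x‖` is
  -- then arbitrarily small relative to `‖x‖`, which no bounded inverse allows. The number `η` is
  -- the value at which the two bounds collide.
  have hnu : ¬ IsUnit P := by
    rintro ⟨U, hU⟩
    set V : H →L[𝕜] H := ↑U⁻¹ with hV
    have hVP : ∀ x, V (P x) = x := fun x => by
      rw [← hU, hV, ← mul_apply_eq_comp, Units.inv_mul]; rfl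
    set C := ‖V‖ + 1 with hC
    have hC0 : 0 < C := by positivity
    have hx : ∀ x, ‖x‖ ≤ C * ‖P x‖ := fun x => by
      have := V.le_opNorm (P x)
      rw [hVP] at this
      nlinarith [norm_nonneg (P x)]
    set η := 1 / (C ^ 2 * K) with hη
    have hη0 : 0 < η := by positivity
    have hlt : s < Real.sqrt (s ^ 2 + η) := Real.lt_sqrt_of_sq_lt (by linarith)
    obtain ⟨t, ⟨x, hx0, rfl⟩, ht⟩ := exists_lt_of_csInf_lt ⟨_, hfQ⟩ hlt
    have hxp := norm_pos_iff.2 hx0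
    rw [div_lt_iff₀ hxp] at ht
    have h1 : ‖B x‖ ^ 2 < (s ^ 2 + η) * ‖x‖ ^ 2 := by
      have := pow_lt_pow_left₀ ht (norm_nonneg _) two_ne_zero
      rwa [mul_pow, Real.sq_sqrt (by positivity)] at this
    have h2 := hCS x
    rw [hPq] at h2
    have h3 : ‖x‖ ^ 2 ≤ C ^ 2 * ‖P x‖ ^ 2 := by
      rw [← mul_pow]; exact pow_le_pow_left₀ hxp.le (hx x) 2
    have h4 : C ^ 2 * ‖P x‖ ^ 2 ≤ C ^ 2 * (K * (‖B x‖ ^ 2 - s ^ 2 * ‖x‖ ^ 2)) := by gcongr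
    have h5 : C ^ 2 * (K * (‖B x‖ ^ 2 - s ^ 2 * ‖x‖ ^ 2)) < C ^ 2 * (K * (η * ‖x‖ ^ 2)) := by
      gcongr
      linarith
    have h6 : C ^ 2 * (K * (η * ‖x‖ ^ 2)) = ‖x‖ ^ 2 := by
      rw [hη]; field_simp
    linarith
  -- This is the factorization `B² - s² = (B - s)(B + s)` with `B = A - r`, both signs reversed; one
  -- of the factors must fail to be invertible.
  have hfac : P = (algebraMap 𝕜 (H →L[𝕜] H) ((r + s : ℝ) : 𝕜) - A) *
      (algebraMap 𝕜 (H →L[𝕜] H) ((r - s : ℝ) : 𝕜) - A) := by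
    ext x
    rw [hPx, hBx, hBx]
    have hal : ∀ (t : 𝕜) (y : H), (algebraMap 𝕜 (H →L[𝕜] H) t) y = t • y := fun t y => by
      rw [Algebra.algebraMap_eq_smul_one]; rfl
    simp only [mul_apply_eq_comp, sub_apply, hal, map_sub, map_smul, RCLike.ofReal_add,
      RCLike.ofReal_pow]
    module
  rw [hfac] at hnu
  by_cases h1 : IsUnit (algebraMap 𝕜 (H →L[𝕜] H) ((r + s : ℝ) : 𝕜) - A)
  · have h2 : ¬ IsUnit (algebraMap 𝕜 (H →L[𝕜] H) ((r - s : ℝ) : 𝕜) - A) :=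
      fun h => hnu (h1.mul h)
    refine ⟨_, h2, ?_⟩
    rw [← RCLike.ofReal_sub, RCLike.norm_ofReal, sub_sub_cancel_left, abs_neg, abs_of_nonneg hs0]
    exact hsδ
  · refine ⟨_, h1, ?_⟩
    rw [← RCLike.ofReal_sub, RCLike.norm_ofReal, add_sub_cancel_left, abs_of_nonneg hs0]
    exact hsδ

end Spectral

end HighContrast

namespace HighContrast
namespace Medium

variable {d : ℕ} (M : Medium d)

theorem p_symm (x y : Space d) : M.p x y = M.p y x := by
  rw [p, p, M.w_symm, mul_comm (M.stiff.indicator _ x)]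

/-! ### The operator behind the form, and scaling. -/

section FormIdentity

variable {𝕜 : Type*} [RCLike 𝕜]

/-- The operator `z ↦ m z - hop z - c z`, on functions. -/
noncomputable def resid (c : 𝕜) (z : Space d → 𝕜) (y : Space d) : 𝕜 :=
  (M.m y : 𝕜) * z y - M.hop z y - c * z y

/-- The substitutions `ξ ↦ -ξ` and `x ↦ x + ξ` exchange the two endpoints of a jump; evenness of `a`
and symmetry of `p` leave the kernel unchanged. -/
theorem integral_kernel_swap (F : Space d → Space d → 𝕜) :
    ∫ ξ, ∫ x, ((M.a ξ * M.p x (x + ξ) : ℝ) : 𝕜) * F (x + ξ) x =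
      ∫ ξ, ∫ x, ((M.a ξ * M.p x (x + ξ) : ℝ) : 𝕜) * F x (x + ξ) := by
  rw [← integral_neg_eq_self]
  refine integral_congr_ae (Eventually.of_forall fun ξ => ?_)
  change ∫ x, ((M.a (-ξ) * M.p x (x + -ξ) : ℝ) : 𝕜) * F (x + -ξ) x = _
  rw [← integral_add_right_eq_self _ ξ]
  refine integral_congr_ae (Eventually.of_forall fun x => ?_)
  change ((M.a (-ξ) * M.p (x + ξ) (x + ξ + -ξ) : ℝ) : 𝕜) * F (x + ξ + -ξ) (x + ξ) = _
  rw [add_neg_cancel_right, M.a_even, M.p_symm]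

/-- Justifies Fubini for half of the form. The integrand is dominated by `a ξ` times squares of `u`
and `v` at the two endpoints; the squares at `x + ξ` reduce to those at `x` by a measure-preserving
shear. -/
theorem integrable_kernel_mul {u v : Space d → 𝕜} (hu : Measurable u) (hv : Measurable v)
    (hu2 : MemLp u 2 volume) (hv2 : MemLp v 2 volume) :
    Integrable (Function.uncurry fun ξ x : Space d => ((M.a ξ * M.p x (x + ξ) : ℝ) : 𝕜) *
      (starRingEnd 𝕜 (u x - u (x + ξ)) * v x)) ((volume : Measure (Space d)).prod volume) := by
  obtain ⟨C, hC⟩ := M.exists_p_le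
  have h1 : Integrable (fun q : Space d × Space d => M.a q.1 * ‖u q.2‖ ^ 2)
      ((volume : Measure (Space d)).prod volume) := M.integrable_a.mul_prod hu2.norm.integrable_sq
  have h2 : Integrable (fun q : Space d × Space d => M.a q.1 * ‖v q.2‖ ^ 2)
      ((volume : Measure (Space d)).prod volume) := M.integrable_a.mul_prod hv2.norm.integrable_sq
  have h3 : Integrable (fun q : Space d × Space d => M.a q.1 * ‖u (q.2 + q.1)‖ ^ 2)
      ((volume : Measure (Space d)).prod volume) := by
    have h := (measurePreserving_prod_add (volume : Measure (Space d)) volume).integrable_comp_of_integrable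
      (g := fun q : Space d × Space d => M.a q.1 * ‖u q.2‖ ^ 2) h1
    simpa [Function.comp_def, add_comm] using h
  have hm : AEStronglyMeasurable (Function.uncurry fun ξ x : Space d =>
      ((M.a ξ * M.p x (x + ξ) : ℝ) : 𝕜) * (starRingEnd 𝕜 (u x - u (x + ξ)) * v x))
      ((volume : Measure (Space d)).prod volume) := by
    have hk : AEMeasurable (fun q : Space d × Space d => M.a q.1 * M.p q.2 (q.2 + q.1))
        ((volume : Measure (Space d)).prod volume) :=
      (M.integrable_a.aestronglyMeasurable.aemeasurable.comp_quasiMeasurePreserving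
        Measure.quasiMeasurePreserving_fst).mul (M.measurable_p.comp
        (f := fun q : Space d × Space d => (q.2, q.2 + q.1)) (by fun_prop)).aemeasurable
    have hu' : Measurable (fun q : Space d × Space d => u q.2 - u (q.2 + q.1)) :=
      (hu.comp (by fun_prop)).sub (hu.comp (by fun_prop))
    have hv' : Measurable (fun q : Space d × Space d => v q.2) := hv.comp (by fun_prop)
    exact ((RCLike.measurable_ofReal (𝕜 := 𝕜).comp_aemeasurable hk).mul
      ((RCLike.continuous_conj.measurable.comp hu').mul hv').aemeasurable).aestronglyMeasurable
  refine (((h1.add h2).add (h3.add h2)).const_mul (C : ℝ)).mono' hm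
    (Eventually.of_forall fun q => ?_)
  rcases q with ⟨ξ, x⟩
  simp only [Function.uncurry_apply_pair, Pi.add_apply]
  rw [norm_mul, RCLike.norm_ofReal, abs_mul, abs_of_nonneg (M.a_nonneg ξ), norm_mul,
    RCLike.norm_conj]
  have e1 := norm_sub_le (u x) (u (x + ξ))
  have e2 : ‖u x - u (x + ξ)‖ * ‖v x‖ ≤ ‖u x‖ ^ 2 + ‖v x‖ ^ 2 + (‖u (x + ξ)‖ ^ 2 + ‖v x‖ ^ 2) := by
    nlinarith [norm_nonneg (v x), sq_nonneg (‖u x‖ - ‖v x‖), sq_nonneg (‖u (x + ξ)‖ - ‖v x‖),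
      sq_nonneg (‖u x‖), sq_nonneg (‖u (x + ξ)‖), sq_nonneg (‖v x‖),
      mul_le_mul_of_nonneg_right e1 (norm_nonneg (v x))]
  have ha := M.a_nonneg ξ
  calc M.a ξ * |M.p x (x + ξ)| * (‖u x - u (x + ξ)‖ * ‖v x‖)
      ≤ M.a ξ * C * (‖u x‖ ^ 2 + ‖v x‖ ^ 2 + (‖u (x + ξ)‖ ^ 2 + ‖v x‖ ^ 2)) := by
        gcongr
        exact hC _ _
    _ = _ := by ring

theorem integrable_kernel (y : Space d) :
    Integrable (fun ξ => M.a ξ * M.p y (y + ξ)) volume := by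
  obtain ⟨C, hC⟩ := M.exists_p_le
  exact M.integrable_a.mul_bdd (c := (C : ℝ)) (M.measurable_p.comp
    (f := fun ξ : Space d => (y, y + ξ)) (by fun_prop)).aestronglyMeasurable
    (Eventually.of_forall fun ξ => hC _ _)

/-- The product of differences splits into a term with `v x` and a term with `v (x + ξ)`. Exchanging
the endpoints shows that they have equal integrals, whence the factor 2 in `m` and `hop`. -/
theorem softForm_one {u v : Space d → 𝕜} (hu : Measurable u) (hv : Measurable v)
    (hu2 : MemLp u 2 volume) (hv2 : MemLp v 2 volume) :
    M.softForm 1 u v = ∫ x, starRingEnd 𝕜 (M.resid 0 u x) * v x := by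
  have hI := M.integrable_kernel_mul hu hv hu2 hv2
  set G : Space d → Space d → 𝕜 := fun ξ x => ((M.a ξ * M.p x (x + ξ) : ℝ) : 𝕜) *
      (starRingEnd 𝕜 (u x - u (x + ξ)) * v x) with hG
  set G' : Space d → Space d → 𝕜 := fun ξ x => ((M.a ξ * M.p x (x + ξ) : ℝ) : 𝕜) *
      (starRingEnd 𝕜 (u (x + ξ) - u x) * v (x + ξ)) with hG'
  have hF : ∀ ξ x, M.formIntegrand 1 u v ξ x = G ξ x + G' ξ x := fun ξ x => by
    simp only [formIntegrand, hG, hG', inv_one, one_smul, map_sub]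
    ring
  have hI0 : Integrable (Function.uncurry (M.formIntegrand 1 u v))
      ((volume : Measure (Space d)).prod volume) := M.integrable_formIntegrand 1 hu hv hu2 hv2
  have hI' : Integrable (Function.uncurry G') ((volume : Measure (Space d)).prod volume) := by
    refine (hI0.sub hI).congr (Eventually.of_forall fun q => ?_)
    rcases q with ⟨ξ, x⟩
    simp [hF]
  have hsum : M.softForm 1 u v = (∫ ξ, ∫ x, G ξ x) + ∫ ξ, ∫ x, G' ξ x := by
    rw [softForm]
    simp_rw [hF]
    exact integral_integral_add' hI hI'
  have hswap : ∫ ξ, ∫ x, G' ξ x = ∫ ξ, ∫ x, G ξ x :=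
    M.integral_kernel_swap fun x y => starRingEnd 𝕜 (u x - u y) * v x
  rw [hsum, hswap, integral_integral_swap hI, ← two_mul, ← integral_const_mul]
  refine integral_congr_ae ?_
  filter_upwards [M.ae_integrable_hop hu hu2] with x hx
  have h1 : Integrable (fun ξ => ((M.a ξ * M.p x (x + ξ) : ℝ) : 𝕜) * u x) volume :=
    (M.integrable_kernel x).ofReal.mul_const _
  have h2 : ∀ ξ, G ξ x = starRingEnd 𝕜 (((M.a ξ * M.p x (x + ξ) : ℝ) : 𝕜) * u x -
      ((M.a ξ * M.p x (x + ξ) : ℝ) : 𝕜) * u (x + ξ)) * v x := fun ξ => by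
    simp only [hG, map_sub, map_mul, RCLike.conj_ofReal]
    ring
  simp_rw [h2]
  rw [integral_mul_const, integral_conj, integral_sub h1 hx, integral_mul_const, integral_ofReal,
    resid, m, hop, ← mul_assoc]
  congr 1
  simp only [map_sub, map_mul, map_zero, map_ofNat, zero_mul]
  ring

/-- Scaling of the form. -/
theorem softForm_scale {ε : ℝ} (hε : 0 < ε) (u v : Space d → 𝕜) :
    M.softForm ε u v = ((ε ^ d : ℝ) : 𝕜) *
      M.softForm 1 (fun y => u (ε • y)) (fun y => v (ε • y)) := by
  rw [softForm, softForm, ← integral_const_mul]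
  refine integral_congr_ae (Eventually.of_forall fun ξ => ?_)
  have h := Measure.integral_comp_smul (volume : Measure (Space d)) (M.formIntegrand ε u v ξ) ε
  rw [finrank_euclideanSpace_fin, abs_of_pos (by positivity)] at h
  have h2 : ∀ y, M.formIntegrand ε u v ξ (ε • y) =
      M.formIntegrand 1 (fun y => u (ε • y)) (fun y => v (ε • y)) ξ y := fun y => by
    simp only [formIntegrand, inv_one, one_smul, smul_add, inv_smul_smul₀ hε.ne']
  simp_rw [h2] at h
  change _ = _ * ∫ y, _
  rw [h, RCLike.real_smul_eq_coe_mul, ← mul_assoc, ← RCLike.ofReal_mul,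
    mul_inv_cancel₀ (by positivity), RCLike.ofReal_one, one_mul]

theorem memLp_hop {z : Space d → 𝕜} (hz : Measurable z) (hz2 : MemLp z 2 volume) :
    MemLp (M.hop z) 2 volume := by
  obtain ⟨C, hC⟩ := M.exists_p_le
  refine ⟨M.aestronglyMeasurable_hop hz, (M.eLpNorm_hop_le hC hz).trans_lt ?_⟩
  have h1 : ∫⁻ ξ, ‖M.a ξ‖ₑ < ∞ := M.integrable_a.2
  have h2 := hz2.2
  finiteness

theorem memLp_resid (c : 𝕜) {z : Space d → 𝕜} (hz : Measurable z) (hz2 : MemLp z 2 volume) :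
    MemLp (M.resid c z) 2 volume := by
  obtain ⟨K, hK⟩ := M.exists_abs_m_le
  have h1 : MemLp (fun y => (M.m y : 𝕜) * z y) 2 volume := by
    refine MemLp.of_le_mul (c := K) hz2 ((RCLike.continuous_ofReal.comp_aestronglyMeasurable
      M.aestronglyMeasurable_m).mul hz.aestronglyMeasurable) (Eventually.of_forall fun y => ?_)
    rw [norm_mul, RCLike.norm_ofReal]
    exact mul_le_mul_of_nonneg_right (hK y) (norm_nonneg _)
  exact (h1.sub (M.memLp_hop hz hz2)).sub (hz2.const_mul c)

theorem resid_congr (c : 𝕜) {z z' : Space d → 𝕜} (h : z =ᵐ[volume] z') :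
    M.resid c z =ᵐ[volume] M.resid c z' := by
  filter_upwards [h] with y hy
  rw [resid, resid, M.hop_congr h, hy]

/-- The operator `m - hop` is symmetric. -/
theorem integral_resid_conj_symm {u v : Space d → 𝕜} (hu : Measurable u) (hv : Measurable v)
    (hu2 : MemLp u 2 volume) (hv2 : MemLp v 2 volume) :
    ∫ x, starRingEnd 𝕜 (M.resid 0 u x) * v x = ∫ x, starRingEnd 𝕜 (u x) * M.resid 0 v x := by
  rw [← M.softForm_one hu hv hu2 hv2, M.softForm_conj_symm, M.softForm_one hv hu hv2 hu2,
    ← integral_conj]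
  congr 1; ext x
  simp [mul_comm]

end FormIdentity

end Medium
-- Norms in `L²(E)` and dilations.
section L2On

variable {d : ℕ} {𝕜 : Type*} [RCLike 𝕜] {E : Set (Space d)}

theorem ofReal_norm_L2On (f : L2On 𝕜 E) :
    ENNReal.ofReal ‖f‖ = eLpNorm (f : Lp 𝕜 2 (volume : Measure (Space d))) 2 volume := by
  rw [Submodule.norm_coe f |>.symm, ofReal_norm, Lp.enorm_def]

theorem L2On_norm_le_iff (f g : L2On 𝕜 E) {δ : ℝ} (hδ : 0 ≤ δ) :
    ‖f‖ ≤ δ * ‖g‖ ↔ eLpNorm (f : Lp 𝕜 2 (volume : Measure (Space d))) 2 volume ≤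
      ENNReal.ofReal δ * eLpNorm (g : Lp 𝕜 2 (volume : Measure (Space d))) 2 volume := by
  rw [← ofReal_norm_L2On, ← ofReal_norm_L2On, ← ENNReal.ofReal_mul hδ,
    ENNReal.ofReal_le_ofReal_iff (by positivity)]

theorem L2On_eLpNorm_ne_zero_iff (f : L2On 𝕜 E) :
    eLpNorm (f : Lp 𝕜 2 (volume : Measure (Space d))) 2 volume ≠ 0 ↔ f ≠ 0 := by
  rw [← ofReal_norm_L2On, ne_eq, ENNReal.ofReal_eq_zero, not_le, norm_pos_iff]

theorem exists_L2On_ae_eq {z : Space d → 𝕜} (hz : MemLp z 2 volume)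
    (hz0 : ∀ᵐ x, x ∉ E → z x = 0) :
    ∃ f : L2On 𝕜 E, (f : Lp 𝕜 2 (volume : Measure (Space d))) =ᵐ[volume] z := by
  refine ⟨⟨hz.toLp z, ?_⟩, hz.coeFn_toLp⟩
  change ∀ᵐ x, _
  filter_upwards [hz0, hz.coeFn_toLp] with x h1 h2 hx
  rw [h2, h1 hx]

end L2On

section Dilation

variable {d : ℕ} {𝕜 : Type*} [RCLike 𝕜]

/-- The constant does not depend on `h`, so it cancels when the norm of a residual is compared with
the norm of the function. -/
theorem exists_eLpNorm_comp_smul {r : ℝ} (hr : r ≠ 0) : ∃ c : ℝ≥0∞, c ≠ 0 ∧ c ≠ ∞ ∧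
    ∀ h : Space d → 𝕜, eLpNorm (fun x => h (r • x)) 2 volume = c * eLpNorm h 2 volume := by
  have hpos : 0 < |(r ^ Module.finrank ℝ (Space d))⁻¹| := by positivity
  refine ⟨ENNReal.ofReal |(r ^ Module.finrank ℝ (Space d))⁻¹| ^ (1 / 2 : ℝ≥0∞).toReal, ?_, ?_,
    fun h => ?_⟩
  · exact (ENNReal.rpow_pos (ENNReal.ofReal_pos.2 hpos) ENNReal.ofReal_ne_top).ne'
  · exact ENNReal.rpow_ne_top_of_nonneg (by positivity) ENNReal.ofReal_ne_top
  · have h1 := (Homeomorph.smulOfNeZero r hr (α := Space d)).measurableEmbedding.eLpNorm_map_measure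
      (p := 2) (μ := volume) (g := h)
    change eLpNorm h 2 (Measure.map (fun x => r • x) volume) = _ at h1
    rw [Measure.map_addHaar_smul _ hr, eLpNorm_smul_measure_of_ne_top (by norm_num),
      smul_eq_mul] at h1
    exact h1.symm

theorem quasiMeasurePreserving_const_smul {r : ℝ} (hr : r ≠ 0) :
    Measure.QuasiMeasurePreserving (fun x : Space d => r • x) volume volume := by
  refine ⟨measurable_const_smul r, ?_⟩
  rw [Measure.map_addHaar_smul _ hr]
  exact Measure.smul_absolutelyContinuous

theorem memLp_comp_smul {r : ℝ} (hr : r ≠ 0) {h : Space d → 𝕜} (hh : MemLp h 2 volume) :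
    MemLp (fun x => h (r • x)) 2 volume := by
  obtain ⟨c, -, hc, hc'⟩ := exists_eLpNorm_comp_smul (d := d) (𝕜 := 𝕜) hr
  refine ⟨hh.1.comp_quasiMeasurePreserving (quasiMeasurePreserving_const_smul hr), ?_⟩
  rw [hc']
  have := hh.2
  finiteness

end Dilation

namespace Medium

variable {d : ℕ} (M : Medium d) {𝕜 : Type*} [RCLike 𝕜]

attribute [local irreducible] vertexOperator softOperator

/-! ### Vertex operators as compressions, and their approximate eigenfunctions. -/

section Vertex

/-- Off the vertex part `z` vanishes, so the multiplication terms vanish there as well, and cutting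
the whole of `resid` agrees with cutting only its nonlocal term. -/
theorem coeFn_vertexOperator_sub_smul (σ : Fin d → Bool) (c : 𝕜) (z : L2On 𝕜 (M.vertexPart σ)) :
    ((M.vertexOperator 𝕜 σ z - c • z : L2On 𝕜 (M.vertexPart σ)) :
      Lp 𝕜 2 (volume : Measure (Space d))) =ᵐ[volume] (M.vertexPart σ).indicator
        (M.resid c (z : Lp 𝕜 2 (volume : Measure (Space d)))) := by
  have hz : ∀ᵐ x, x ∉ M.vertexPart σ → (z : Lp 𝕜 2 (volume : Measure (Space d))) x = 0 := z.2
  filter_upwards [hz, M.coeFn_vertexOperator σ z, Lp.coeFn_sub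
    (M.vertexOperator 𝕜 σ z : Lp 𝕜 2 (volume : Measure (Space d)))
    (c • z : Lp 𝕜 2 (volume : Measure (Space d))),
    Lp.coeFn_smul c (z : Lp 𝕜 2 (volume : Measure (Space d)))] with x h1 h2 h3 h4
  change (((M.vertexOperator 𝕜 σ z : Lp 𝕜 2 (volume : Measure (Space d))) -
    (c • z : Lp 𝕜 2 (volume : Measure (Space d)))) : Lp 𝕜 2 (volume : Measure (Space d))) x = _
  rw [h3, Pi.sub_apply, h2, h4, Pi.smul_apply, vertexFun, smul_eq_mul]
  by_cases hx : x ∈ M.vertexPart σ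
  · rw [Set.indicator_of_mem hx, Set.indicator_of_mem hx, resid]
  · rw [Set.indicator_of_notMem hx, Set.indicator_of_notMem hx, h1 hx]
    simp

theorem inner_vertexOperator (σ : Fin d → Bool) (u v : L2On 𝕜 (M.vertexPart σ)) :
    inner 𝕜 (M.vertexOperator 𝕜 σ u) v =
      ∫ x, starRingEnd 𝕜 (M.resid 0 (u : Lp 𝕜 2 (volume : Measure (Space d))) x) *
        (v : Lp 𝕜 2 (volume : Measure (Space d))) x := by
  rw [Submodule.coe_inner, L2.inner_def]
  have hv : ∀ᵐ x, x ∉ M.vertexPart σ → (v : Lp 𝕜 2 (volume : Measure (Space d))) x = 0 := v.2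
  have h := M.coeFn_vertexOperator_sub_smul σ 0 u
  rw [zero_smul, sub_zero] at h
  refine integral_congr_ae ?_
  filter_upwards [hv, h] with x h1 h2
  rw [h2, RCLike.inner_apply']
  by_cases hx : x ∈ M.vertexPart σ
  · rw [Set.indicator_of_mem hx]
  · rw [h1 hx, mul_zero, mul_zero]

theorem vertexOperator_symm (σ : Fin d → Bool) (u v : L2On 𝕜 (M.vertexPart σ)) :
    inner 𝕜 (M.vertexOperator 𝕜 σ u) v = inner 𝕜 u (M.vertexOperator 𝕜 σ v) := by
  rw [← inner_conj_symm u, inner_vertexOperator, inner_vertexOperator,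
    M.integral_resid_conj_symm (Lp.stronglyMeasurable _).measurable
      (Lp.stronglyMeasurable _).measurable (Lp.memLp _) (Lp.memLp _), ← integral_conj]
  congr 1; ext x
  simp [mul_comm]

/-- Off the spectrum, the vertex operator is bounded below. -/
theorem exists_eLpNorm_le_of_notMem_spectrum (σ : Fin d → Bool) {c : 𝕜}
    (hc : c ∉ spectrum 𝕜 (M.vertexOperator 𝕜 σ)) : ∃ K : ℝ≥0, ∀ z : Space d → 𝕜,
      MemLp z 2 volume → (∀ᵐ x, x ∉ M.vertexPart σ → z x = 0) →
      eLpNorm z 2 volume ≤ K * eLpNorm ((M.vertexPart σ).indicator (M.resid c z)) 2 volume := by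
  rw [spectrum.notMem_iff] at hc
  obtain ⟨V, hV⟩ := hc.exists_left_inv
  refine ⟨‖V‖₊, fun z hz hz0 => ?_⟩
  obtain ⟨f, hf⟩ := exists_L2On_ae_eq hz hz0
  have hinv : V (c • f - M.vertexOperator 𝕜 σ f) = f := by
    have h1 := DFunLike.congr_fun hV f
    rw [Algebra.algebraMap_eq_smul_one] at h1
    exact h1
  have h2 := V.le_opNorm (c • f - M.vertexOperator 𝕜 σ f)
  rw [hinv, norm_sub_rev, L2On_norm_le_iff _ _ (norm_nonneg V), eLpNorm_congr_ae hf,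
    eLpNorm_congr_ae (M.coeFn_vertexOperator_sub_smul σ c f), ofReal_norm, enorm_eq_nnnorm] at h2
  refine h2.trans_eq (congrArg _ (eLpNorm_congr_ae ?_))
  filter_upwards [M.resid_congr c hf] with x hx
  simp only [Set.indicator]
  rw [← hx]

/-- The spectrum of the vertex operator consists of approximate eigenvalues, with approximate
eigenfunctions of bounded support. -/
theorem exists_approx_of_mem_spectrum_vertexOperator (σ : Fin d → Bool) {c : 𝕜}
    (hc : c ∈ spectrum 𝕜 (M.vertexOperator 𝕜 σ)) {δ : ℝ} (hδ : 0 < δ) : ∃ (z : Space d → 𝕜) (R : ℝ),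
      Measurable z ∧ MemLp z 2 volume ∧ (∀ᵐ x, x ∉ M.vertexPart σ → z x = 0) ∧
      (∀ᵐ x, R < ‖x‖ → z x = 0) ∧ eLpNorm z 2 volume ≠ 0 ∧
      eLpNorm ((M.vertexPart σ).indicator (M.resid c z)) 2 volume ≤
        ENNReal.ofReal δ * eLpNorm z 2 volume := by
  obtain ⟨f, -, hf⟩ := exists_approx_eigenvector (A := M.vertexOperator 𝕜 σ) (M.vertexOperator_symm σ) hc hδ
  -- The strict inequality survives a small `L²` perturbation, so `f` may be replaced by a compactly
  -- supported approximation. Cutting that to the vertex part does not increase its distance to `f`,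
  -- and strictness also keeps the result nonzero.
  have hopen : IsOpen {f : L2On 𝕜 (M.vertexPart σ) |
      ‖M.vertexOperator 𝕜 σ f - c • f‖ < δ * ‖f‖} := isOpen_lt (by fun_prop) (by fun_prop)
  obtain ⟨η, hη, hball⟩ := Metric.isOpen_iff.1 hopen f hf
  obtain ⟨g, hg1, hg2, hg3, hg4⟩ := (Lp.memLp (f : Lp 𝕜 2 (volume : Measure
    (Space d)))).exists_hasCompactSupport_eLpNorm_sub_le (by norm_num)
    (ε := ENNReal.ofReal (η / 2)) (by simpa using hη)
  have hfz : ∀ᵐ x, x ∉ M.vertexPart σ → (f : Lp 𝕜 2 (volume : Measure (Space d))) x = 0 := f.2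
  have hm : MemLp ((M.vertexPart σ).indicator g) 2 volume :=
    hg4.indicator (M.measurableSet_vertexPart σ)
  obtain ⟨h, hh⟩ := exists_L2On_ae_eq (E := M.vertexPart σ) hm
    (Eventually.of_forall fun x hx => Set.indicator_of_notMem hx _)
  have hdist : h ∈ Metric.ball f η := by
    rw [Metric.mem_ball, dist_comm, dist_eq_norm]
    have h1 : ENNReal.ofReal ‖f - h‖ ≤ ENNReal.ofReal (η / 2) := by
      rw [ofReal_norm_L2On, Submodule.coe_sub]
      refine le_trans (eLpNorm_mono_ae ?_) hg2
      filter_upwards [hfz, hh, Lp.coeFn_sub (f : Lp 𝕜 2 (volume : Measure (Space d)))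
        (h : Lp 𝕜 2 (volume : Measure (Space d)))] with x h1 h2 h3
      rw [h3, Pi.sub_apply, h2, Pi.sub_apply]
      by_cases hx : x ∈ M.vertexPart σ
      · rw [Set.indicator_of_mem hx]
      · rw [Set.indicator_of_notMem hx, h1 hx]
        simp
    rw [ENNReal.ofReal_le_ofReal_iff (by positivity)] at h1
    linarith
  have hres := hball hdist
  simp only [Set.mem_ofPred_eq] at hres
  obtain ⟨R, hR⟩ := hg1.isCompact.isBounded.subset_closedBall 0
  refine ⟨(h : Lp 𝕜 2 (volume : Measure (Space d))), R, (Lp.stronglyMeasurable _).measurable,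
    Lp.memLp _, h.2, ?_, ?_, ?_⟩
  · filter_upwards [hh] with x hx hxR
    rw [hx]
    have : g x = 0 := by
      by_contra hne
      have := hR (subset_tsupport _ hne)
      rw [mem_closedBall_zero_iff] at this
      linarith
    by_cases hxE : x ∈ M.vertexPart σ
    · rw [Set.indicator_of_mem hxE, this]
    · rw [Set.indicator_of_notMem hxE]
  · rw [L2On_eLpNorm_ne_zero_iff]
    rintro rfl
    rw [norm_zero, mul_zero] at hres
    exact absurd hres (norm_nonneg _).not_gt
  · rw [← eLpNorm_congr_ae (M.coeFn_vertexOperator_sub_smul σ c h)]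
    exact (L2On_norm_le_iff _ _ hδ.le).1 hres.le

end Vertex

/-! ### The soft operator read at unit scale. -/

section Soft

theorem softOperator_symm (S : Set (Space d)) (ε : ℝ) (u v : L2On 𝕜 (M.softPart S ε)) :
    inner 𝕜 (M.softOperator 𝕜 S ε u) v = inner 𝕜 u (M.softOperator 𝕜 S ε v) := by
  rw [← inner_conj_symm u, inner_softOperator, inner_softOperator, ← M.softForm_conj_symm]

theorem measurableSet_softPart {S : Set (Space d)} (hS : MeasurableSet S) (ε : ℝ) :
    MeasurableSet (M.softPart S ε) :=
  (M.isOpen_soft.measurableSet.preimage (measurable_const_smul _)).inter hS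

/-- Pairing with an arbitrary `b` identifies the operator: the factor `ε ^ d` from scaling the form
cancels the Jacobian of the dilation. -/
theorem coeFn_softOperator {S : Set (Space d)} (hS : MeasurableSet S) {ε : ℝ} (hε : 0 < ε)
    (f : L2On 𝕜 (M.softPart S ε)) :
    ((M.softOperator 𝕜 S ε f : L2On 𝕜 (M.softPart S ε)) : Lp 𝕜 2 (volume : Measure (Space d)))
      =ᵐ[volume] (M.softPart S ε).indicator (fun x => M.resid 0
        (fun y => (f : Lp 𝕜 2 (volume : Measure (Space d))) (ε • y)) (ε⁻¹ • x)) := by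
  have hmeas : ∀ b : Lp 𝕜 2 (volume : Measure (Space d)), Measurable (fun y => b (ε • y)) :=
    fun b => (Lp.stronglyMeasurable b).measurable.comp (measurable_const_smul ε)
  have hmem : ∀ b : Lp 𝕜 2 (volume : Measure (Space d)), MemLp (fun y => b (ε • y)) 2 volume :=
    fun b => memLp_comp_smul hε.ne' (Lp.memLp b)
  have hq : MemLp ((M.softPart S ε).indicator (fun x => M.resid 0
      (fun y => (f : Lp 𝕜 2 (volume : Measure (Space d))) (ε • y)) (ε⁻¹ • x))) 2 volume :=
    (memLp_comp_smul (inv_ne_zero hε.ne') (M.memLp_resid 0 (hmeas _) (hmem _))).indicator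
      (M.measurableSet_softPart hS ε)
  obtain ⟨q, hq'⟩ := exists_L2On_ae_eq (E := M.softPart S ε) hq
    (Eventually.of_forall fun x hx => Set.indicator_of_notMem hx _)
  have key : M.softOperator 𝕜 S ε f = q := by
    refine ext_inner_right 𝕜 fun b => ?_
    have hb : ∀ᵐ x, x ∉ M.softPart S ε → (b : Lp 𝕜 2 (volume : Measure (Space d))) x = 0 := b.2
    rw [inner_softOperator, M.softForm_scale hε, M.softForm_one (hmeas _) (hmeas _) (hmem _)
      (hmem _), Submodule.coe_inner, L2.inner_def]
    have h1 := Measure.integral_comp_smul (volume : Measure (Space d)) (fun x =>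
      starRingEnd 𝕜 (M.resid 0 (fun y => (f : Lp 𝕜 2 (volume : Measure (Space d))) (ε • y))
        (ε⁻¹ • x)) * (b : Lp 𝕜 2 (volume : Measure (Space d))) x) ε
    simp only [inv_smul_smul₀ hε.ne'] at h1
    rw [finrank_euclideanSpace_fin, abs_of_pos (by positivity)] at h1
    rw [h1, RCLike.real_smul_eq_coe_mul, ← mul_assoc, ← RCLike.ofReal_mul,
      mul_inv_cancel₀ (by positivity), RCLike.ofReal_one, one_mul]
    refine integral_congr_ae ?_
    filter_upwards [hb, hq'] with x h2 h3
    rw [h3, RCLike.inner_apply']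
    by_cases hx : x ∈ M.softPart S ε
    · simp only [Set.indicator_of_mem hx]
    · rw [h2 hx, mul_zero, mul_zero]
  rw [key]
  exact hq'

/-- In the variable `ε⁻¹ • x` the scale survives only in the domain `M.soft ∩ {y | ε • y ∈ S}`; the
operator being cut is the same for all `ε`. -/
theorem coeFn_softOperator_sub_smul {S : Set (Space d)} (hS : MeasurableSet S) {ε : ℝ}
    (hε : 0 < ε) (c : 𝕜) (f : L2On 𝕜 (M.softPart S ε)) :
    ((M.softOperator 𝕜 S ε f - c • f : L2On 𝕜 (M.softPart S ε)) :
      Lp 𝕜 2 (volume : Measure (Space d))) =ᵐ[volume]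
        fun x => (M.soft ∩ {y | ε • y ∈ S}).indicator (M.resid c
          (fun y => (f : Lp 𝕜 2 (volume : Measure (Space d))) (ε • y))) (ε⁻¹ • x) := by
  have hz : ∀ᵐ x, x ∉ M.softPart S ε → (f : Lp 𝕜 2 (volume : Measure (Space d))) x = 0 := f.2
  filter_upwards [hz, M.coeFn_softOperator hS hε f, Lp.coeFn_sub
    (M.softOperator 𝕜 S ε f : Lp 𝕜 2 (volume : Measure (Space d)))
    (c • f : Lp 𝕜 2 (volume : Measure (Space d))),
    Lp.coeFn_smul c (f : Lp 𝕜 2 (volume : Measure (Space d)))] with x h1 h2 h3 h4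
  change (((M.softOperator 𝕜 S ε f : Lp 𝕜 2 (volume : Measure (Space d))) -
    (c • f : Lp 𝕜 2 (volume : Measure (Space d)))) : Lp 𝕜 2 (volume : Measure (Space d))) x = _
  rw [h3, Pi.sub_apply, h2, h4, Pi.smul_apply, smul_eq_mul]
  have hiff : ε⁻¹ • x ∈ M.soft ∩ {y | ε • y ∈ S} ↔ x ∈ M.softPart S ε := by
    simp [softPart, smul_inv_smul₀ hε.ne']
  by_cases hx : x ∈ M.softPart S ε
  · rw [Set.indicator_of_mem hx, Set.indicator_of_mem (hiff.2 hx), resid, resid,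
      smul_inv_smul₀ hε.ne']
    ring
  · rw [Set.indicator_of_notMem hx, Set.indicator_of_notMem (hiff.not.2 hx), h1 hx]
    simp

/-- Dilating an abstract approximate eigenvector to unit scale multiplies its norm and that of its
residual by the same constant, so `δ` is kept. -/
theorem exists_approx_of_mem_spectrum_softOperator {S : Set (Space d)} (hS : MeasurableSet S)
    {ε : ℝ} (hε : 0 < ε) {c : 𝕜} (hc : c ∈ spectrum 𝕜 (M.softOperator 𝕜 S ε)) {δ : ℝ}
    (hδ : 0 < δ) : ∃ z : Space d → 𝕜,
      Measurable z ∧ MemLp z 2 volume ∧ (∀ᵐ x, x ∉ M.soft ∩ {y | ε • y ∈ S} → z x = 0) ∧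
      eLpNorm z 2 volume ≠ 0 ∧
      eLpNorm ((M.soft ∩ {y | ε • y ∈ S}).indicator (M.resid c z)) 2 volume ≤
        ENNReal.ofReal δ * eLpNorm z 2 volume := by
  obtain ⟨f, hf0, hf⟩ := exists_approx_eigenvector (A := M.softOperator 𝕜 S ε) (M.softOperator_symm S ε) hc hδ
  obtain ⟨k, hk0, hk, hk'⟩ := exists_eLpNorm_comp_smul (d := d) (𝕜 := 𝕜) (inv_ne_zero hε.ne')
  have hnorm : eLpNorm (f : Lp 𝕜 2 (volume : Measure (Space d))) 2 volume =
      k * eLpNorm (fun y => (f : Lp 𝕜 2 (volume : Measure (Space d))) (ε • y)) 2 volume := by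
    rw [← hk']
    simp only [smul_inv_smul₀ hε.ne']
  refine ⟨fun y => (f : Lp 𝕜 2 (volume : Measure (Space d))) (ε • y),
    (Lp.stronglyMeasurable _).measurable.comp (measurable_const_smul ε),
    memLp_comp_smul hε.ne' (Lp.memLp _), ?_, ?_, ?_⟩
  · have hz : ∀ᵐ x, x ∉ M.softPart S ε → (f : Lp 𝕜 2 (volume : Measure (Space d))) x = 0 := f.2
    filter_upwards [(quasiMeasurePreserving_const_smul hε.ne').ae hz] with x hx hxS
    refine hx fun h => hxS ?_
    simpa [softPart, inv_smul_smul₀ hε.ne'] using h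
  · intro h0
    rw [h0, mul_zero] at hnorm
    exact (L2On_eLpNorm_ne_zero_iff f).2 hf0 hnorm
  · have h1 := (L2On_norm_le_iff _ _ hδ.le).1 hf.le
    rw [eLpNorm_congr_ae (M.coeFn_softOperator_sub_smul hS hε c f), hnorm, hk',
      mul_left_comm, ENNReal.mul_le_mul_iff_right hk0 hk] at h1
    exact h1

/-- The reverse passage: a unit-scale test function is dilated back and its relative residual bounds
the distance to the spectrum. -/
theorem exists_mem_spectrum_softOperator_near {S : Set (Space d)} (hS : MeasurableSet S)
    {ε : ℝ} (hε : 0 < ε) (r : ℝ) {δ : ℝ} (hδ : 0 ≤ δ) {z : Space d → 𝕜}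
    (hz : MemLp z 2 volume) (hz0 : ∀ᵐ x, x ∉ M.soft ∩ {y | ε • y ∈ S} → z x = 0)
    (hne : eLpNorm z 2 volume ≠ 0)
    (hres : eLpNorm ((M.soft ∩ {y | ε • y ∈ S}).indicator (M.resid (r : 𝕜) z)) 2 volume ≤
        ENNReal.ofReal δ * eLpNorm z 2 volume) :
    ∃ c ∈ spectrum 𝕜 (M.softOperator 𝕜 S ε), ‖c - r‖ ≤ δ := by
  have hε' := inv_ne_zero hε.ne'
  obtain ⟨k, hk0, hk, hk'⟩ := exists_eLpNorm_comp_smul (d := d) (𝕜 := 𝕜) hε'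
  have hm : MemLp (fun x => z (ε⁻¹ • x)) 2 volume := memLp_comp_smul hε' hz
  obtain ⟨f, hf⟩ := exists_L2On_ae_eq (E := M.softPart S ε) hm (by
    filter_upwards [(quasiMeasurePreserving_const_smul hε').ae hz0] with x h1 hx
    refine h1 fun h => hx ?_
    simpa [softPart, smul_inv_smul₀ hε.ne'] using h)
  have hnorm : eLpNorm (f : Lp 𝕜 2 (volume : Measure (Space d))) 2 volume =
      k * eLpNorm z 2 volume := by
    rw [eLpNorm_congr_ae hf, hk']
  have hfz : (fun y => (f : Lp 𝕜 2 (volume : Measure (Space d))) (ε • y)) =ᵐ[volume] z := by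
    filter_upwards [(quasiMeasurePreserving_const_smul hε.ne').ae hf] with y hy
    rw [hy, inv_smul_smul₀ hε.ne']
  refine exists_mem_spectrum_near (A := M.softOperator 𝕜 S ε) (M.softOperator_symm S ε) r (f := f)
    ?_ ?_
  · rw [← L2On_eLpNorm_ne_zero_iff, hnorm]
    exact mul_ne_zero hk0 hne
  · rw [L2On_norm_le_iff _ _ hδ, hnorm,
      eLpNorm_congr_ae (M.coeFn_softOperator_sub_smul hS hε _ f), hk', mul_left_comm]
    refine mul_le_mul_right (le_trans (le_of_eq (eLpNorm_congr_ae ?_)) hres) _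
    filter_upwards [M.resid_congr (r : 𝕜) hfz] with x hx
    simp only [Set.indicator]
    rw [← hx]

end Soft

end Medium
-- Young's inequality.
section Young

variable {d : ℕ} {𝕜 : Type*} [RCLike 𝕜]

/-- Young's inequality for the convolution of an integrable and a square integrable function. -/
theorem lintegral_conv_sq_le {b : Space d → ℝ≥0∞} (hb : AEMeasurable b volume)
    (hb' : ∫⁻ ξ, b ξ ≠ ∞) {z : Space d → 𝕜} (hz : Measurable z) :
    ∫⁻ y, (∫⁻ ξ, b ξ * ‖z (y + ξ)‖ₑ) ^ (2 : ℝ) ≤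
      (∫⁻ ξ, b ξ) ^ (2 : ℝ) * ∫⁻ y, ‖z y‖ₑ ^ (2 : ℝ) := by
  have hbt : ∀ᵐ ξ, b ξ < ∞ := ae_lt_top' hb hb'
  have hpow : ∀ t : ℝ≥0∞, (t ^ (1 / 2 : ℝ)) ^ (2 : ℝ) = t := fun t => by
    rw [← ENNReal.rpow_mul]; norm_num
  have h1 : ∀ y, (∫⁻ ξ, b ξ * ‖z (y + ξ)‖ₑ) ^ (2 : ℝ) ≤
      (∫⁻ ξ, b ξ) * ∫⁻ ξ, b ξ * ‖z (y + ξ)‖ₑ ^ (2 : ℝ) := by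
    intro y
    have hzy : Measurable (fun ξ => ‖z (y + ξ)‖ₑ) := (hz.comp (by fun_prop)).enorm
    -- Cauchy–Schwarz after writing `b` as the product of two square roots; Tonelli and translation
    -- invariance do the rest.
    have h := ENNReal.lintegral_mul_le_Lp_mul_Lq (volume : Measure (Space d))
      Real.HolderConjugate.two_two (hb.pow_const (1 / 2 : ℝ))
      ((hb.pow_const (1 / 2 : ℝ)).mul hzy.aemeasurable)
    simp only [Pi.mul_apply, ENNReal.mul_rpow_of_nonneg _ _ (by norm_num : (0 : ℝ) ≤ 2),
      hpow] at h
    have h' := ENNReal.rpow_le_rpow h (by norm_num : (0 : ℝ) ≤ 2)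
    rw [ENNReal.mul_rpow_of_nonneg _ _ (by norm_num : (0 : ℝ) ≤ 2), hpow, hpow] at h'
    refine le_trans (le_of_eq ?_) h'
    congr 2; ext ξ
    rw [← mul_assoc, ← ENNReal.rpow_add_of_nonneg _ _ (by norm_num) (by norm_num)]
    norm_num
  have hF : AEMeasurable (Function.uncurry fun y ξ : Space d =>
      b ξ * ‖z (y + ξ)‖ₑ ^ (2 : ℝ)) ((volume : Measure (Space d)).prod volume) := by
    have hz' : Measurable (fun q : Space d × Space d => ‖z (q.1 + q.2)‖ₑ ^ (2 : ℝ)) :=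
      (hz.comp (by fun_prop : Measurable fun q : Space d × Space d => q.1 + q.2)).enorm.pow_const _
    exact (hb.comp_quasiMeasurePreserving Measure.quasiMeasurePreserving_snd).mul hz'.aemeasurable
  calc ∫⁻ y, (∫⁻ ξ, b ξ * ‖z (y + ξ)‖ₑ) ^ (2 : ℝ)
      ≤ ∫⁻ y, (∫⁻ ξ, b ξ) * ∫⁻ ξ, b ξ * ‖z (y + ξ)‖ₑ ^ (2 : ℝ) := lintegral_mono h1
    _ = (∫⁻ ξ, b ξ) * ∫⁻ y, ∫⁻ ξ, b ξ * ‖z (y + ξ)‖ₑ ^ (2 : ℝ) := lintegral_const_mul' _ _ hb'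
    _ = (∫⁻ ξ, b ξ) * ∫⁻ ξ, ∫⁻ y, b ξ * ‖z (y + ξ)‖ₑ ^ (2 : ℝ) := by
        rw [lintegral_lintegral_swap hF]
    _ = (∫⁻ ξ, b ξ) * ∫⁻ ξ, b ξ * ∫⁻ y, ‖z y‖ₑ ^ (2 : ℝ) := by
        congr 1
        refine lintegral_congr_ae ?_
        filter_upwards [hbt] with ξ hξ
        rw [lintegral_const_mul' _ _ hξ.ne]
        congr 1
        exact lintegral_add_right_eq_self (fun y => ‖z y‖ₑ ^ (2 : ℝ)) ξ
    _ = _ := by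
        rw [lintegral_mul_const'' _ hb, ENNReal.rpow_two]
        ring

theorem eLpNorm_le_of_le_conv {b : Space d → ℝ≥0∞} (hb : AEMeasurable b volume)
    (hb' : ∫⁻ ξ, b ξ ≠ ∞) {z g : Space d → 𝕜} (hz : Measurable z)
    (hg : ∀ᵐ y, ‖g y‖ₑ ≤ ∫⁻ ξ, b ξ * ‖z (y + ξ)‖ₑ) :
    eLpNorm g 2 volume ≤ (∫⁻ ξ, b ξ) * eLpNorm z 2 volume := by
  have h2 : ∫⁻ y, ‖g y‖ₑ ^ (2 : ℝ) ≤ (∫⁻ ξ, b ξ) ^ (2 : ℝ) * ∫⁻ y, ‖z y‖ₑ ^ (2 : ℝ) := by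
    refine (lintegral_mono_ae ?_).trans (lintegral_conv_sq_le hb hb' hz)
    filter_upwards [hg] with y hy
    exact ENNReal.rpow_le_rpow hy (by norm_num)
  have h3 := ENNReal.rpow_le_rpow h2 (by norm_num : (0 : ℝ) ≤ 1 / 2)
  rw [ENNReal.mul_rpow_of_nonneg _ _ (by norm_num : (0 : ℝ) ≤ 1 / 2), ← ENNReal.rpow_mul] at h3
  rw [eLpNorm_eq_lintegral_rpow_enorm_toReal (by norm_num) (by norm_num),
    eLpNorm_eq_lintegral_rpow_enorm_toReal (by norm_num) (by norm_num)]
  simpa using h3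

end Young

namespace Medium

variable {d : ℕ} (M : Medium d) {𝕜 : Type*} [RCLike 𝕜]

/-! ### Commutators with Lipschitz cutoffs. -/

section Commutator

/-- The second moment controls the first, because `t ≤ 1 + t ^ 2`. -/
theorem lintegral_a_mul_norm_lt_top : ∫⁻ ξ, ‖M.a ξ‖ₑ * ‖ξ‖ₑ < ∞ := by
  refine lt_of_le_of_lt (lintegral_mono fun ξ => ?_) M.a_integrable.2
  rw [enorm_mul]
  gcongr
  rw [← ofReal_norm, ← ofReal_norm]
  refine ENNReal.ofReal_le_ofReal ?_
  rw [Real.norm_of_nonneg (by positivity)]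
  nlinarith [sq_nonneg (‖ξ‖ - 1)]

variable (𝕜) in
/-- The commutator of the nonlocal part with the multiplication by a Lipschitz function. -/
theorem exists_eLpNorm_commutator_le : ∃ K : ℝ≥0, ∀ (κ : ℝ≥0) (χ : Space d → ℝ)
    (z : Space d → 𝕜), Measurable χ → (∀ x y, |χ x - χ y| ≤ κ * ‖x - y‖) → Measurable z →
    MemLp z 2 volume → MemLp (fun x => (χ x : 𝕜) * z x) 2 volume →
    eLpNorm (fun y => M.hop (fun x => (χ x : 𝕜) * z x) y - (χ y : 𝕜) * M.hop z y) 2 volume ≤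
      K * κ * eLpNorm z 2 volume := by
  obtain ⟨C, hC⟩ := M.exists_p_le
  have hfin := M.lintegral_a_mul_norm_lt_top
  -- The factors are the 2 in `hop`, the bound for `p`, and the first moment of `a`.
  refine ⟨2 * C * (∫⁻ ξ, ‖M.a ξ‖ₑ * ‖ξ‖ₑ).toNNReal, fun κ χ z hχ hL hz hz2 hχz => ?_⟩
  have hab : AEMeasurable (fun ξ => ‖M.a ξ‖ₑ * ‖ξ‖ₑ) volume :=
    M.integrable_a.aestronglyMeasurable.enorm.mul (by fun_prop)
  have hint : ∫⁻ ξ, (2 * C * κ : ℝ≥0∞) * (‖M.a ξ‖ₑ * ‖ξ‖ₑ) =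
      2 * C * κ * ∫⁻ ξ, ‖M.a ξ‖ₑ * ‖ξ‖ₑ := lintegral_const_mul' _ _ (by finiteness)
  have hmain := eLpNorm_le_of_le_conv (b := fun ξ => (2 * C * κ : ℝ≥0∞) * (‖M.a ξ‖ₑ * ‖ξ‖ₑ))
    (hab.const_mul _) (by rw [hint]; finiteness) hz
    (g := fun y => M.hop (fun x => (χ x : 𝕜) * z x) y - (χ y : 𝕜) * M.hop z y) ?_
  · refine hmain.trans_eq ?_
    rw [hint]
    push_cast
    rw [ENNReal.coe_toNNReal hfin.ne]
    ring
  have hχ' : Measurable (fun x => (χ x : 𝕜) * z x) := (RCLike.measurable_ofReal.comp hχ).mul hz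
  filter_upwards [M.ae_integrable_hop hz hz2, M.ae_integrable_hop hχ' hχz] with y h1 h2
  have e : ∀ r : ℝ, ‖(r : 𝕜)‖ₑ = ‖r‖ₑ := fun r => by
    rw [← ofReal_norm, ← ofReal_norm, RCLike.norm_ofReal, Real.norm_eq_abs]
  -- The commutator has kernel `a p (χ (y + ξ) - χ y)`; the Lipschitz bound turns its last factor
  -- into `κ ‖ξ‖`, and Young's inequality applies with weight `a ξ ‖ξ‖`.
  have h3 : M.hop (fun x => (χ x : 𝕜) * z x) y - (χ y : 𝕜) * M.hop z y =
      2 * ∫ ξ, ((M.a ξ * M.p y (y + ξ) : ℝ) : 𝕜) * (((χ (y + ξ) - χ y : ℝ) : 𝕜) * z (y + ξ)) := by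
    rw [hop, hop, mul_left_comm, ← mul_sub, ← integral_const_mul, ← integral_sub h2
      (h1.const_mul _)]
    congr 2; ext ξ
    rw [RCLike.ofReal_sub]
    ring
  rw [h3, enorm_mul]
  have h4 : ‖(2 : 𝕜)‖ₑ = 2 := by rw [← ofReal_norm, RCLike.norm_ofNat]; simp
  rw [h4]
  calc 2 * ‖∫ ξ, ((M.a ξ * M.p y (y + ξ) : ℝ) : 𝕜) * (((χ (y + ξ) - χ y : ℝ) : 𝕜) * z (y + ξ))‖ₑ
      ≤ 2 * ∫⁻ ξ, ‖((M.a ξ * M.p y (y + ξ) : ℝ) : 𝕜) *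
          (((χ (y + ξ) - χ y : ℝ) : 𝕜) * z (y + ξ))‖ₑ := by
        gcongr
        exact enorm_integral_le_lintegral_enorm _
    _ = ∫⁻ ξ, 2 * ‖((M.a ξ * M.p y (y + ξ) : ℝ) : 𝕜) *
          (((χ (y + ξ) - χ y : ℝ) : 𝕜) * z (y + ξ))‖ₑ :=
        (lintegral_const_mul' _ _ (by finiteness)).symm
    _ ≤ _ := by
        refine lintegral_mono fun ξ => ?_
        rw [enorm_mul, enorm_mul, e, e, enorm_mul]
        have h5 : ‖M.p y (y + ξ)‖ₑ ≤ C := by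
          rw [← ofReal_norm, Real.norm_eq_abs, ← ENNReal.ofReal_coe_nnreal]
          exact ENNReal.ofReal_le_ofReal (hC _ _)
        have h6 : ‖χ (y + ξ) - χ y‖ₑ ≤ κ * ‖ξ‖ₑ := by
          rw [← ofReal_norm, ← ofReal_norm, Real.norm_eq_abs, ← ENNReal.ofReal_coe_nnreal,
            ← ENNReal.ofReal_mul (NNReal.coe_nonneg κ)]
          refine ENNReal.ofReal_le_ofReal ((hL _ _).trans_eq ?_)
          rw [add_sub_cancel_left]
        calc 2 * (‖M.a ξ‖ₑ * ‖M.p y (y + ξ)‖ₑ * (‖χ (y + ξ) - χ y‖ₑ * ‖z (y + ξ)‖ₑ))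
            ≤ 2 * (‖M.a ξ‖ₑ * C * (κ * ‖ξ‖ₑ * ‖z (y + ξ)‖ₑ)) := by gcongr
          _ = _ := by ring

end Commutator

/-! ### Lattice invariance. -/

section Translation

theorem p_add_latticeVec (k : Fin d → ℤ) (x y : Space d) :
    M.p (x + latticeVec k) (y + latticeVec k) = M.p x y := by
  have h : ∀ x, M.stiff.indicator (fun _ => (1 : ℝ)) (x + latticeVec k) =
      M.stiff.indicator (fun _ => 1) x := fun x => by
    by_cases hx : x ∈ M.stiff
    · rw [Set.indicator_of_mem hx, Set.indicator_of_mem ((M.stiff_periodic k x).2 hx)]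
    · rw [Set.indicator_of_notMem hx,
        Set.indicator_of_notMem ((M.stiff_periodic k x).not.2 hx)]
  rw [p, p, M.w_periodic_left, M.w_periodic_right, h, h]

/-- The coefficient sees a simultaneous lattice shift of both arguments as no shift at all. This is
what makes the corners of all large boxes look alike. -/
theorem resid_comp_add_latticeVec (c : 𝕜) (z : Space d → 𝕜) (k : Fin d → ℤ) (y : Space d) :
    M.resid c (fun x => z (x + latticeVec k)) y = M.resid c z (y + latticeVec k) := by
  have hp : ∀ ξ, M.p (y + latticeVec k) (y + latticeVec k + ξ) = M.p y (y + ξ) := fun ξ => by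
    rw [add_right_comm, M.p_add_latticeVec]
  rw [resid, resid, m, m, hop, hop]
  simp only [hp, add_right_comm y _ (latticeVec k)]

end Translation

end Medium

/-! ### Large boxes, orthants and the partition of unity. -/

section Geometry

variable {d : ℕ}

/-- Lets the difference between the open box and the closed orthant on their common faces be
ignored. -/
theorem ae_coord_ne (j : Fin d) (c : ℝ) : ∀ᵐ x : Space d, x j ≠ c :=
  (EuclideanSpace.volume_preserving_symm_measurableEquiv_toLp (Fin d)).quasiMeasurePreserving.ae
    (Measure.ae_eval_ne (μ := fun _ => (volume : Measure ℝ)) j c)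

theorem isOpen_box (l : Fin d → ℕ) : IsOpen (box l) := by
  have : box l = ⋂ j, {x : Space d | 0 < x j ∧ x j < (l j : ℝ)} := by ext x; simp [box]
  rw [this]
  refine isOpen_iInter_of_finite fun j => ?_
  have hc : Continuous fun x : Space d => x j := by fun_prop
  exact (isOpen_lt continuous_const hc).inter (isOpen_lt hc continuous_const)

/-- Indices start at zero, hence `N + 1`. The enlarged edges are again integers, so the vertices
stay in the lattice. -/
theorem smul_mem_box_iff (l : Fin d → ℕ) (N : ℕ) :
    {y : Space d | (1 / ((N : ℝ) + 1)) • y ∈ box l} = box (fun j => (N + 1) * l j) := by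
  ext y
  have hN : (0 : ℝ) < (N : ℝ) + 1 := by positivity
  simp only [box, Set.mem_ofPred_eq, PiLp.smul_apply, smul_eq_mul, one_div]
  refine forall_congr' fun j => and_congr ?_ ?_
  · exact mul_pos_iff_of_pos_left (by positivity)
  · rw [inv_mul_lt_iff₀ hN]
    push_cast
    rfl

/-- The translation that moves the vertex `σ` of the box to the origin. -/
def vertexShift (σ : Fin d → Bool) (L : Fin d → ℕ) : Fin d → ℤ :=
  fun j => if σ j = true then -(L j : ℤ) else 0

theorem latticeVec_neg (k : Fin d → ℤ) : latticeVec (-k) = -latticeVec k := by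
  ext j; simp [latticeVec]

theorem add_vertexShift_mem_orthant_iff (σ : Fin d → Bool) (L : Fin d → ℕ) (x : Space d) :
    x + latticeVec (vertexShift σ L) ∈ orthant σ ↔
      ∀ j, if σ j = true then x j ≤ (L j : ℝ) else 0 ≤ x j := by
  refine forall_congr' fun j => ?_
  by_cases h : σ j = true <;> simp [vertexShift, latticeVec, h]

theorem add_vertexShift_mem_orthant {σ : Fin d → Bool} {L : Fin d → ℕ} {x : Space d}
    (hx : x ∈ box L) : x + latticeVec (vertexShift σ L) ∈ orthant σ := by
  rw [add_vertexShift_mem_orthant_iff]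
  intro j
  split_ifs
  · exact (hx j).2.le
  · exact (hx j).1.le

/-- Truncation to the unit interval. -/
noncomputable def clamp (t : ℝ) : ℝ := max 0 (min 1 t)

theorem clamp_mem (t : ℝ) : 0 ≤ clamp t ∧ clamp t ≤ 1 :=
  ⟨le_max_left _ _, max_le zero_le_one (min_le_left _ _)⟩

theorem abs_clamp_sub_le (s t : ℝ) : |clamp s - clamp t| ≤ |s - t| := by
  refine (abs_max_sub_max_le_max _ _ _ _).trans ?_
  rw [sub_self, abs_zero]
  refine max_le (abs_nonneg _) ((abs_min_sub_min_le_max _ _ _ _).trans ?_)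
  rw [sub_self, abs_zero]
  exact max_le (abs_nonneg _) le_rfl

theorem clamp_of_nonpos {t : ℝ} (ht : t ≤ 0) : clamp t = 0 :=
  max_eq_left ((min_le_right _ _).trans ht)

theorem clamp_of_one_le {t : ℝ} (ht : 1 ≤ t) : clamp t = 1 := by
  rw [clamp, min_eq_left ht, max_eq_right zero_le_one]

/-- One factor of the cutoff functions: a hat that is `1` at one end of the unit interval
and `0` at the other end. -/
noncomputable def hat (b : Bool) (t : ℝ) : ℝ := if b = true then clamp t else 1 - clamp t

theorem hat_mem (b : Bool) (t : ℝ) : 0 ≤ hat b t ∧ hat b t ≤ 1 := by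
  have := clamp_mem t
  rw [hat]
  split_ifs
  · exact this
  · constructor <;> linarith

theorem abs_hat_sub_le (b : Bool) (s t : ℝ) : |hat b s - hat b t| ≤ |s - t| := by
  rw [hat, hat]
  split_ifs
  · exact abs_clamp_sub_le s t
  · rw [sub_sub_sub_cancel_left, abs_sub_comm s t]
    exact abs_clamp_sub_le t s

/-- A partition of unity subordinate to the vertices of a box. -/
noncomputable def cutoff (L : Fin d → ℕ) (σ : Fin d → Bool) (x : Space d) : ℝ :=
  ∏ j, hat (σ j) (x j / L j)

theorem cutoff_mem (L : Fin d → ℕ) (σ : Fin d → Bool) (x : Space d) :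
    0 ≤ cutoff L σ x ∧ cutoff L σ x ≤ 1 :=
  ⟨Finset.prod_nonneg fun _ _ => (hat_mem _ _).1,
    Finset.prod_le_one (fun _ _ => (hat_mem _ _).1) fun _ _ => (hat_mem _ _).2⟩

/-- Expanding the product over `j` of the sums of the two hats, each equal to 1, gives one term for
every vertex. -/
theorem sum_cutoff (L : Fin d → ℕ) (x : Space d) : ∑ σ, cutoff L σ x = 1 := by
  have h := Finset.prod_univ_sum (fun _ : Fin d => (Finset.univ : Finset Bool))
    (fun j b => hat b (x j / L j))
  rw [Fintype.piFinset_univ] at h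
  simp only [cutoff]
  rw [← h]
  exact Finset.prod_eq_one fun j _ => by simp [hat]

/-- Factors are exchanged one at a time; the remaining ones lie in the unit interval and cost
nothing. -/
theorem abs_prod_sub_prod_le {ι : Type*} (s : Finset ι) (f g : ι → ℝ)
    (hf : ∀ i, 0 ≤ f i ∧ f i ≤ 1) (hg : ∀ i, 0 ≤ g i ∧ g i ≤ 1) :
    |∏ i ∈ s, f i - ∏ i ∈ s, g i| ≤ ∑ i ∈ s, |f i - g i| := by
  classical
  induction s using Finset.induction_on with
  | empty => simp
  | insert i s hi ih =>
    rw [Finset.prod_insert hi, Finset.prod_insert hi, Finset.sum_insert hi]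
    have h1 : f i * ∏ i ∈ s, f i - g i * ∏ i ∈ s, g i =
        (f i - g i) * ∏ i ∈ s, f i + g i * (∏ i ∈ s, f i - ∏ i ∈ s, g i) := by ring
    have hp0 : 0 ≤ ∏ i ∈ s, f i := Finset.prod_nonneg fun i _ => (hf i).1
    have hp1 : ∏ i ∈ s, f i ≤ 1 := Finset.prod_le_one (fun i _ => (hf i).1) fun i _ => (hf i).2
    rw [h1]
    refine (abs_add_le _ _).trans (add_le_add ?_ ?_)
    · rw [abs_mul, abs_of_nonneg hp0]
      exact mul_le_of_le_one_right (abs_nonneg _) hp1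
    · rw [abs_mul, abs_of_nonneg (hg i).1]
      exact (mul_le_of_le_one_left (abs_nonneg _) (hg i).2).trans ih

/-- Each of the `d` hats varies over a length of at least `n`. -/
theorem abs_cutoff_sub_le {L : Fin d → ℕ} {n : ℕ} (hn : 0 < n) (hL : ∀ j, n ≤ L j)
    (σ : Fin d → Bool) (x y : Space d) :
    |cutoff L σ x - cutoff L σ y| ≤ ((d / n : ℝ≥0) : ℝ) * ‖x - y‖ := by
  refine (abs_prod_sub_prod_le _ _ _ (fun _ => hat_mem _ _) fun _ => hat_mem _ _).trans ?_
  have hn' : (0 : ℝ) < n := by exact_mod_cast hn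
  have h : ∀ j ∈ (Finset.univ : Finset (Fin d)),
      |hat (σ j) (x j / L j) - hat (σ j) (y j / L j)| ≤ ‖x - y‖ / n := fun j _ => by
    refine (abs_hat_sub_le _ _ _).trans ?_
    have hLj : (n : ℝ) ≤ L j := by exact_mod_cast hL j
    have hLj0 : (0 : ℝ) < L j := hn'.trans_le hLj
    rw [← sub_div, abs_div, abs_of_pos hLj0]
    have := PiLp.norm_apply_le (x - y) j
    rw [Real.norm_eq_abs] at this
    exact div_le_div₀ (norm_nonneg _) this hn' hLj
  refine (Finset.sum_le_sum h).trans_eq ?_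
  rw [Finset.sum_const, Finset.card_univ, Fintype.card_fin, nsmul_eq_mul]
  push_cast
  ring

theorem continuous_cutoff (L : Fin d → ℕ) (σ : Fin d → Bool) : Continuous (cutoff L σ) := by
  refine continuous_finsetProd _ fun j _ => ?_
  have h : Continuous (hat (σ j)) :=
    (LipschitzWith.mk_one fun s t => abs_hat_sub_le (σ j) s t).continuous
  exact h.comp (by fun_prop)

/-- In the translated orthant, the cutoff of a vertex vanishes outside the box. -/
theorem ae_cutoff_eq_zero {L : Fin d → ℕ} (hL : ∀ j, 0 < L j) (σ : Fin d → Bool) :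
    ∀ᵐ x : Space d, x + latticeVec (vertexShift σ L) ∈ orthant σ → x ∉ box L →
      cutoff L σ x = 0 := by
  filter_upwards [ae_all_iff.2 fun j => ae_coord_ne (d := d) j 0,
    ae_all_iff.2 fun j => ae_coord_ne (d := d) j (L j : ℝ)] with x h0 h1 hx hbox
  rw [add_vertexShift_mem_orthant_iff] at hx
  simp only [box, Set.mem_ofPred_eq, not_forall] at hbox
  obtain ⟨j, hj⟩ := hbox
  -- A point of the orthant, off the null hyperplanes, can leave the box in coordinate `j` only
  -- across the face opposite to the vertex, where the corresponding hat is zero.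
  refine Finset.prod_eq_zero (Finset.mem_univ j) ?_
  have hxj := hx j
  have hLj : (0 : ℝ) < L j := by exact_mod_cast hL j
  by_cases hσ : σ j = true
  · rw [if_pos hσ] at hxj
    have hlt := lt_of_le_of_ne hxj (h1 j)
    have h2 : x j ≤ 0 := by
      by_contra hcon
      exact hj ⟨not_le.1 hcon, hlt⟩
    rw [hat, if_pos hσ, clamp_of_nonpos (div_nonpos_of_nonpos_of_nonneg h2 hLj.le)]
  · rw [if_neg hσ] at hxj
    have hlt := lt_of_le_of_ne hxj (h0 j).symm
    have h2 : (L j : ℝ) ≤ x j := by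
      by_contra hcon
      exact hj ⟨hlt, not_le.1 hcon⟩
    rw [hat, if_neg hσ, clamp_of_one_le ((one_le_div hLj).2 h2), sub_self]

end Geometry

/-! ### Comparison of a large box with the orthants at its vertices. -/

namespace Medium

variable {d : ℕ} (M : Medium d) {𝕜 : Type*} [RCLike 𝕜]

theorem eLpNorm_comp_add (z : Space d → 𝕜) (v : Space d) :
    eLpNorm (fun x => z (x + v)) 2 volume = eLpNorm z 2 volume := by
  have h := (measurableEmbedding_addRight v).eLpNorm_map_measure (p := 2)
    (μ := (volume : Measure (Space d))) (g := z)
  rw [map_add_right_eq_self] at h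
  exact h.symm

theorem vertexPart_add_iff (σ : Fin d → Bool) (k : Fin d → ℤ) (x : Space d) :
    x + latticeVec k ∈ M.vertexPart σ ↔ x + latticeVec k ∈ orthant σ ∧ x ∈ M.soft := by
  rw [vertexPart, Set.mem_inter_iff, M.soft_periodic]

theorem indicator_vertexPart_resid_comp (σ : Fin d → Bool) (c : 𝕜) (z : Space d → 𝕜)
    (k : Fin d → ℤ) :
    eLpNorm ({x | x + latticeVec k ∈ M.vertexPart σ}.indicator
      (M.resid c fun x => z (x + latticeVec k))) 2 volume =
    eLpNorm ((M.vertexPart σ).indicator (M.resid c z)) 2 volume := by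
  rw [← eLpNorm_comp_add ((M.vertexPart σ).indicator (M.resid c z)) (latticeVec k)]
  congr 1
  ext x
  by_cases hx : x + latticeVec k ∈ M.vertexPart σ
  · have hx' : x ∈ {x | x + latticeVec k ∈ M.vertexPart σ} := hx
    rw [Set.indicator_of_mem hx, Set.indicator_of_mem hx', resid_comp_add_latticeVec]
  · have hx' : x ∉ {x | x + latticeVec k ∈ M.vertexPart σ} := hx
    rw [Set.indicator_of_notMem hx, Set.indicator_of_notMem hx']

/-- Approximate eigenfunctions of bounded support in an orthant can be moved into a large box. -/
theorem exists_approx_box (σ : Fin d → Bool) (c : 𝕜) {z : Space d → 𝕜} {R : ℝ}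
    (hz2 : MemLp z 2 volume) (hz0 : ∀ᵐ x, x ∉ M.vertexPart σ → z x = 0)
    (hR : ∀ᵐ x, R < ‖x‖ → z x = 0) {L : Fin d → ℕ} (hL : ∀ j, R < L j) :
    ∃ h : Space d → 𝕜, MemLp h 2 volume ∧ (∀ᵐ x, x ∉ M.soft ∩ box L → h x = 0) ∧
      eLpNorm h 2 volume = eLpNorm z 2 volume ∧
      eLpNorm ((M.soft ∩ box L).indicator (M.resid c h)) 2 volume ≤
        eLpNorm ((M.vertexPart σ).indicator (M.resid c z)) 2 volume := by
  set k := vertexShift σ L with hk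
  have hmp := measurePreserving_add_right (volume : Measure (Space d)) (latticeVec k)
  refine ⟨fun x => z (x + latticeVec k), hz2.comp_measurePreserving hmp, ?_,
    eLpNorm_comp_add z _, ?_⟩
  · filter_upwards [hmp.quasiMeasurePreserving.ae hz0, hmp.quasiMeasurePreserving.ae hR,
      ae_all_iff.2 fun j => ae_coord_ne (d := d) j 0,
      ae_all_iff.2 fun j => ae_coord_ne (d := d) j (L j : ℝ)] with x h1 h2 h3 h4 hx
    by_contra hne
    have hv : x + latticeVec k ∈ M.vertexPart σ := by
      by_contra h; exact hne (h1 h)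
    have hn : ‖x + latticeVec k‖ ≤ R := by
      by_contra h; exact hne (h2 (not_le.1 h))
    rw [vertexPart_add_iff] at hv
    refine hx ⟨hv.2, fun j => ?_⟩
    have ho := (add_vertexShift_mem_orthant_iff σ L x).1 hv.1 j
    -- Support within distance `R < L j` of the vertex cannot reach the opposite face; the faces
    -- through the vertex are null.
    have hj := (PiLp.norm_apply_le (x + latticeVec k) j).trans hn
    rw [Real.norm_eq_abs, abs_le] at hj
    have hLj := hL j
    by_cases hσ : σ j = true
    · rw [if_pos hσ] at ho
      have e : (x + latticeVec k) j = x j - L j := by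
        simp [hk, vertexShift, latticeVec, hσ, sub_eq_add_neg]
      rw [e] at hj
      exact ⟨by linarith, lt_of_le_of_ne ho (h4 j)⟩
    · rw [if_neg hσ] at ho
      have e : (x + latticeVec k) j = x j := by simp [hk, vertexShift, latticeVec, hσ]
      rw [e] at hj
      exact ⟨lt_of_le_of_ne ho (h3 j).symm, by linarith⟩
  · rw [← M.indicator_vertexPart_resid_comp σ c z k]
    refine eLpNorm_mono fun x => ?_
    by_cases hx : x ∈ M.soft ∩ box L
    · have hx' : x ∈ {x | x + latticeVec k ∈ M.vertexPart σ} :=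
        (M.vertexPart_add_iff σ k x).2 ⟨add_vertexShift_mem_orthant hx.2, hx.1⟩
      rw [Set.indicator_of_mem hx, Set.indicator_of_mem hx']
    · rw [Set.indicator_of_notMem hx, norm_zero]
      exact norm_nonneg _

/-- Lower bounds for all vertex operators give a lower bound for the operator of a large box. -/
theorem exists_eLpNorm_le_box {c : 𝕜} {K : ℝ≥0} (hK : ∀ (σ : Fin d → Bool) (z : Space d → 𝕜),
      MemLp z 2 volume → (∀ᵐ x, x ∉ M.vertexPart σ → z x = 0) →
      eLpNorm z 2 volume ≤ K * eLpNorm ((M.vertexPart σ).indicator (M.resid c z)) 2 volume) :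
    ∃ K' : ℝ≥0, ∀ (L : Fin d → ℕ) (n : ℕ), 0 < n → (∀ j, n ≤ L j) → ∀ z : Space d → 𝕜,
      Measurable z → MemLp z 2 volume → (∀ᵐ x, x ∉ M.soft ∩ box L → z x = 0) →
      eLpNorm z 2 volume ≤ K' * (eLpNorm ((M.soft ∩ box L).indicator (M.resid c z)) 2 volume +
        (1 / n : ℝ≥0) * eLpNorm z 2 volume) := by
  obtain ⟨K₁, hK₁⟩ := M.exists_eLpNorm_commutator_le 𝕜
  -- One lower bound `K` per vertex; `K₁ * d` comes from the commutator with cutoffs of Lipschitz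
  -- constant `d / n`.
  refine ⟨Fintype.card (Fin d → Bool) * (K * max 1 (K₁ * d)), fun L n hn hL z hz hz2 hz0 => ?_⟩
  set T := eLpNorm ((M.soft ∩ box L).indicator (M.resid c z)) 2 volume with hT
  set Z := eLpNorm z 2 volume with hZ
  have hLpos : ∀ j, 0 < L j := fun j => hn.trans_le (hL j)
  have hcm : ∀ σ, MemLp (fun x => (cutoff L σ x : 𝕜) * z x) 2 volume := fun σ => by
    refine hz2.of_le ((RCLike.continuous_ofReal.comp
      (continuous_cutoff L σ)).measurable.mul hz).aestronglyMeasurable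
      (Eventually.of_forall fun x => ?_)
    rw [norm_mul, RCLike.norm_ofReal, abs_of_nonneg (cutoff_mem L σ x).1]
    exact mul_le_of_le_one_left (norm_nonneg _) (cutoff_mem L σ x).2
  have hσ : ∀ σ, eLpNorm (fun x => (cutoff L σ x : 𝕜) * z x) 2 volume ≤
      K * (T + K₁ * (d / n : ℝ≥0) * Z) := fun σ => by
    set k := vertexShift σ L with hk
    set u : Space d → 𝕜 := fun x => (cutoff L σ x : 𝕜) * z x with hu
    have hum : Measurable u :=
      (RCLike.continuous_ofReal.comp (continuous_cutoff L σ)).measurable.mul hz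
    have hmp := measurePreserving_add_right (volume : Measure (Space d)) (latticeVec (-k))
    have hback : ∀ x, u (x + latticeVec k + latticeVec (-k)) = u x := fun x => by
      rw [latticeVec_neg, add_neg_cancel_right]
    -- The localized piece is moved to the orthant at the origin, where the hypothesis applies; the
    -- resulting estimate is then carried back to the box.
    have hmain := hK σ (fun x => u (x + latticeVec (-k))) ((hcm σ).comp_measurePreserving hmp) (by
      filter_upwards [hmp.quasiMeasurePreserving.ae hz0] with x h1 hx
      have h2 : x + latticeVec (-k) ∉ M.soft ∩ box L := fun h => hx (by
        have h3 := (M.vertexPart_add_iff σ k (x + latticeVec (-k))).2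
          ⟨add_vertexShift_mem_orthant h.2, h.1⟩
        rwa [latticeVec_neg, neg_add_cancel_right] at h3)
      simp only [hu, h1 h2, mul_zero])
    rw [eLpNorm_comp_add, ← M.indicator_vertexPart_resid_comp σ c _ k] at hmain
    simp only [hback] at hmain
    refine hmain.trans ?_
    gcongr
    set W : Space d → 𝕜 := fun y => M.hop u y - (cutoff L σ y : 𝕜) * M.hop z y with hW
    have hWn : eLpNorm W 2 volume ≤ K₁ * (d / n : ℝ≥0) * Z :=
      hK₁ _ _ z (continuous_cutoff L σ).measurable (abs_cutoff_sub_le hn hL σ) hz hz2 (hcm σ)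
    have hWm : AEStronglyMeasurable W volume :=
      (M.aestronglyMeasurable_hop hum).sub ((RCLike.continuous_ofReal.comp
        (continuous_cutoff L σ)).aestronglyMeasurable.mul (M.aestronglyMeasurable_hop hz))
    have hVm : AEStronglyMeasurable ((M.soft ∩ box L).indicator (M.resid c z)) volume :=
      (M.memLp_resid c hz hz2).1.indicator
        (M.isOpen_soft.inter (isOpen_box L)).measurableSet
    calc _ ≤ eLpNorm (fun x => ‖(M.soft ∩ box L).indicator (M.resid c z) x‖ + ‖W x‖) 2 volume := by
          refine eLpNorm_mono_ae ?_
          filter_upwards [ae_cutoff_eq_zero hLpos σ] with x h1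
          rw [Real.norm_of_nonneg (by positivity)]
          by_cases hx : x ∈ {x | x + latticeVec k ∈ M.vertexPart σ}
          · have hx' := (M.vertexPart_add_iff σ k x).1 hx
            rw [Set.indicator_of_mem hx]
            -- Multiplication terms commute with the cutoff, so only `W` is left over. Outside the
            -- box the cutoff is zero and the residual of `u` is exactly `-W`, so no separate tail
            -- estimate is needed.
            have h2 : M.resid c u x = (cutoff L σ x : 𝕜) *
                (M.soft ∩ box L).indicator (M.resid c z) x - W x := by
              by_cases hb : x ∈ box L
              · have hsb : x ∈ M.soft ∩ box L := ⟨hx'.2, hb⟩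
                rw [Set.indicator_of_mem hsb]
                simp only [resid, hW, hu]
                ring
              · have h3 := h1 hx'.1 hb
                simp only [resid, hW, hu, h3, RCLike.ofReal_zero, zero_mul, mul_zero]
                ring
            rw [h2]
            refine (norm_sub_le _ _).trans ?_
            gcongr
            rw [norm_mul, RCLike.norm_ofReal, abs_of_nonneg (cutoff_mem L σ x).1]
            exact mul_le_of_le_one_left (norm_nonneg _) (cutoff_mem L σ x).2
          · rw [Set.indicator_of_notMem hx, norm_zero]
            positivity
      _ ≤ eLpNorm (fun x => ‖(M.soft ∩ box L).indicator (M.resid c z) x‖) 2 volume +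
          eLpNorm (fun x => ‖W x‖) 2 volume := eLpNorm_add_le hVm.norm hWm.norm (by norm_num)
      _ ≤ _ := by
          rw [eLpNorm_norm, eLpNorm_norm]
          gcongr
  have hsum : z = ∑ σ, fun x => (cutoff L σ x : 𝕜) * z x := by
    ext x
    rw [Finset.sum_apply, ← Finset.sum_mul, ← RCLike.ofReal_sum, sum_cutoff, RCLike.ofReal_one,
      one_mul]
  calc Z = eLpNorm (∑ σ, fun x => (cutoff L σ x : 𝕜) * z x) 2 volume := by rw [hZ, ← hsum]
    _ ≤ ∑ σ, eLpNorm (fun x => (cutoff L σ x : 𝕜) * z x) 2 volume :=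
        eLpNorm_sum_le (fun σ _ => (hcm σ).1) (by norm_num)
    _ ≤ ∑ _σ : Fin d → Bool, (K * (T + K₁ * (d / n : ℝ≥0) * Z) : ℝ≥0∞) :=
        Finset.sum_le_sum fun σ _ => hσ σ
    _ = Fintype.card (Fin d → Bool) * (K * (T + K₁ * (d / n : ℝ≥0) * Z)) := by
        rw [Finset.sum_const, Finset.card_univ, nsmul_eq_mul]
    _ ≤ Fintype.card (Fin d → Bool) * (K * ((max 1 (K₁ * d) : ℝ≥0) * (T + (1 / n : ℝ≥0) * Z))) := by
        have h1 : T ≤ (max 1 (K₁ * d) : ℝ≥0) * T := by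
          refine le_mul_of_one_le_left zero_le ?_
          exact_mod_cast le_max_left 1 (K₁ * (d : ℝ≥0))
        have h2 : (K₁ : ℝ≥0∞) * (d / n : ℝ≥0) * Z ≤
            (max 1 (K₁ * d) : ℝ≥0) * ((1 / n : ℝ≥0) * Z) := by
          have e : (K₁ : ℝ≥0∞) * (d / n : ℝ≥0) = (K₁ * d : ℝ≥0) * (1 / n : ℝ≥0) := by
            rw [← ENNReal.coe_mul, ← ENNReal.coe_mul, mul_assoc, mul_one_div]
          rw [e, mul_assoc]
          gcongr
          exact le_max_right _ _
        gcongr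
        rw [mul_add]
        exact add_le_add h1 h2
    _ = _ := by
        rw [ENNReal.coe_mul, ENNReal.coe_mul, ENNReal.coe_natCast]
        ring

/-- If the soft component is nonempty, then it meets every box. -/
theorem soft_inter_box_nonempty (h : M.soft.Nonempty) {L : Fin d → ℕ} (hL : ∀ j, 0 < L j) :
    (M.soft ∩ box L).Nonempty := by
  have hne : volume M.soft ≠ 0 := (M.isOpen_soft.measure_pos volume h).ne'
  -- The soft set has positive measure, so it contains a point with no integer coordinate.
  -- Subtracting the floors puts that point in the open unit cell, which every such box contains.
  have hae : ∀ᵐ x : Space d, ∀ j, ∀ c : ℤ, x j ≠ (c : ℝ) :=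
    ae_all_iff.2 fun j => ae_all_iff.2 fun c => ae_coord_ne j c
  obtain ⟨x, hx, hxc⟩ : ∃ x ∈ M.soft, ∀ j, ∀ c : ℤ, x j ≠ (c : ℝ) := by
    by_contra! hcon
    refine hne (measure_mono_null (fun x hx => ?_) (ae_iff.1 hae))
    obtain ⟨j, c, hjc⟩ := hcon x hx
    exact fun hh => hh j c hjc
  refine ⟨x + latticeVec fun j => -⌊x j⌋, (M.soft_periodic _ x).2 hx, fun j => ?_⟩
  have e : (x + latticeVec fun j => -⌊x j⌋) j = x j - ⌊x j⌋ := by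
    simp [latticeVec, sub_eq_add_neg]
  have h1 := lt_of_le_of_ne (Int.floor_le (x j)) (hxc j _).symm
  have h2 := Int.lt_floor_add_one (x j)
  have h3 : (1 : ℝ) ≤ L j := by exact_mod_cast hL j
  rw [e]
  constructor <;> linarith

end Medium

/-! ### Passage to the Hausdorff limit. -/

/-- A point at vanishing distance from a sequence of nonempty sets is a limit of points of these
sets. -/
theorem exists_tendsto_of_eventually_near {X : Type*} [PseudoMetricSpace X] {S : ℕ → Set X}
    (hne : ∀ N, (S N).Nonempty) {t : X}
    (h : ∀ δ > 0, ∀ᶠ N in atTop, ∃ s ∈ S N, dist s t ≤ δ) :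
    ∃ s : ℕ → X, (∀ N, s N ∈ S N) ∧ Tendsto s atTop (𝓝 t) := by
  have h1 : ∀ N : ℕ, ∃ s ∈ S N, dist t s < Metric.infDist t (S N) + 1 / ((N : ℝ) + 1) := fun N =>
    (Metric.infDist_lt_iff (hne N)).1 (lt_add_of_pos_right _ (by positivity))
  choose s hs hst using h1
  refine ⟨s, hs, tendsto_iff_dist_tendsto_zero.2 ?_⟩
  have h2 : Tendsto (fun N => Metric.infDist t (S N)) atTop (𝓝 0) := by
    rw [Metric.tendsto_atTop']
    intro δ hδ
    obtain ⟨N₀, hN₀⟩ := eventually_atTop.1 (h (δ / 2) (by positivity))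
    refine ⟨N₀, fun N hN => ?_⟩
    obtain ⟨y, hy, hyt⟩ := hN₀ N hN.le
    rw [Real.dist_0_eq_abs, abs_of_nonneg Metric.infDist_nonneg]
    have := Metric.infDist_le_dist_of_mem (x := t) hy
    rw [dist_comm] at this
    linarith
  refine squeeze_zero (fun _ => dist_nonneg) (fun N => ?_)
    (by simpa using h2.add tendsto_one_div_add_atTop_nhds_zero_nat)
  rw [dist_comm]
  simpa using (hst N).le

namespace Medium

variable {d : ℕ} (M : Medium d) {𝕜 : Type*} [RCLike 𝕜]

/-- Any nonzero test function locates a spectral point within its own relative residual; this works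
over both scalar fields. Needed because the approximating sequence must have a term for every `N`.
-/
theorem spectrum_softOperator_nonempty (h : M.soft.Nonempty) {l : Fin d → ℕ} (hl : ∀ j, 0 < l j)
    (N : ℕ) : (spectrum 𝕜 (M.softOperator 𝕜 (box l) (1 / ((N : ℝ) + 1)))).Nonempty := by
  obtain ⟨y, hy⟩ := M.soft_inter_box_nonempty h (L := fun j => (N + 1) * l j)
    fun j => Nat.mul_pos N.succ_pos (hl j)
  obtain ⟨r, hr, hball⟩ := Metric.isOpen_iff.1 (M.isOpen_soft.inter (isOpen_box _)) y hy
  set z : Space d → 𝕜 := (Metric.ball y r).indicator fun _ => 1 with hz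
  have hzm : Measurable z := measurable_const.indicator Metric.isOpen_ball.measurableSet
  have hz2 : MemLp z 2 volume := memLp_indicator_const 2 Metric.isOpen_ball.measurableSet 1
    (Or.inr measure_ball_lt_top.ne)
  have hne : eLpNorm z 2 volume ≠ 0 := by
    rw [hz, eLpNorm_indicator_const Metric.isOpen_ball.measurableSet (by norm_num) (by norm_num)]
    refine mul_ne_zero (by simp) (ENNReal.rpow_pos (Metric.measure_ball_pos _ _ hr)
      measure_ball_lt_top.ne).ne'
  have hE := M.isOpen_soft.inter (isOpen_box fun j => (N + 1) * l j)
  have hres := ((M.memLp_resid ((0 : ℝ) : 𝕜) hzm hz2).indicator hE.measurableSet).2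
  rw [← smul_mem_box_iff] at hres hball
  obtain ⟨c, hc, -⟩ := M.exists_mem_spectrum_softOperator_near (𝕜 := 𝕜)
    (isOpen_box l).measurableSet (ε := 1 / ((N : ℝ) + 1)) (by positivity) 0
    (δ := (eLpNorm ((M.soft ∩ {y : Space d | (1 / ((N : ℝ) + 1)) • y ∈ box l}).indicator
      (M.resid ((0 : ℝ) : 𝕜) z)) 2 volume / eLpNorm z 2 volume).toReal)
    ENNReal.toReal_nonneg hz2
    (Eventually.of_forall fun x hx => Set.indicator_of_notMem (fun hb => hx (hball hb)) _) hne (by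
      rw [ENNReal.ofReal_toReal (ENNReal.div_ne_top hres.ne hne),
        ENNReal.div_mul_cancel hne hz2.2.ne])
  exact ⟨c, hc⟩

/-- Spectral points of the vertex operators are limits of spectral points of the operators of
large boxes. -/
theorem exists_tendsto_of_mem_spectrum_vertexOperator {l : Fin d → ℕ} (hl : ∀ j, 0 < l j)
    (σ : Fin d → Bool) {t : 𝕜} (ht : t ∈ spectrum 𝕜 (M.vertexOperator 𝕜 σ)) :
    ∃ s : ℕ → 𝕜, (∀ N : ℕ, s N ∈ spectrum 𝕜 (M.softOperator 𝕜 (box l) (1 / ((N : ℝ) + 1)))) ∧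
      Tendsto s atTop (𝓝 t) := by
  have hreal := exists_real_of_mem_spectrum (A := M.vertexOperator 𝕜 σ)
    (M.vertexOperator_symm σ) ht
  refine exists_tendsto_of_eventually_near
    (M.spectrum_softOperator_nonempty ?_ hl) fun δ hδ => ?_
  -- A nonzero function carried by the soft set rules out an empty soft set; the tolerance 1 is
  -- arbitrary.
  · obtain ⟨z, R, -, -, hz0, -, hne, -⟩ :=
      M.exists_approx_of_mem_spectrum_vertexOperator σ ht one_pos
    by_contra hemp
    rw [Set.not_nonempty_iff_eq_empty] at hemp
    refine hne (eLpNorm_eq_zero_of_ae_zero ?_)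
    filter_upwards [hz0] with x hx
    exact hx fun h => by simpa [hemp] using h.2
  · obtain ⟨z, R, -, hz2, hz0, hR, hne, hres⟩ :=
      M.exists_approx_of_mem_spectrum_vertexOperator σ ht hδ
    filter_upwards [eventually_ge_atTop ⌈R⌉₊] with N hN
    have hL : ∀ j, R < (((N + 1) * l j : ℕ) : ℝ) := fun j => by
      have h1 : R ≤ N := (Nat.le_ceil R).trans (by exact_mod_cast hN)
      have h2 : N < (N + 1) * l j := (Nat.lt_succ_self N).trans_le (Nat.le_mul_of_pos_right _ (hl j))
      exact h1.trans_lt (by exact_mod_cast h2)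
    obtain ⟨h, hh2, hh0, hhn, hhr⟩ := M.exists_approx_box σ t hz2 hz0 hR
      (L := fun j => (N + 1) * l j) hL
    rw [← smul_mem_box_iff] at hh0 hhr
    rw [← hreal] at hres hhr
    obtain ⟨c, hc, hcd⟩ := M.exists_mem_spectrum_softOperator_near (𝕜 := 𝕜)
      (isOpen_box l).measurableSet (ε := 1 / ((N : ℝ) + 1)) (by positivity) (RCLike.re t) hδ.le hh2
      hh0 (hhn ▸ hne) (hhn ▸ hhr.trans hres)
    refine ⟨c, hc, ?_⟩
    rw [dist_eq_norm]
    rwa [hreal] at hcd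

/-- Limits of spectral points of the operators of large boxes belong to the spectrum of one of the
vertex operators. -/
theorem mem_iUnion_spectrum_vertexOperator_of_tendsto {l : Fin d → ℕ} (hl : ∀ j, 0 < l j)
    {φ : ℕ → ℕ} {s : ℕ → 𝕜} {t : 𝕜} (hφ : StrictMono φ)
    (hs : ∀ k, s k ∈ spectrum 𝕜 (M.softOperator 𝕜 (box l) (1 / ((φ k : ℝ) + 1))))
    (hst : Tendsto s atTop (𝓝 t)) :
    t ∈ ⋃ σ : Fin d → Bool, spectrum 𝕜 (M.vertexOperator 𝕜 σ) := by
  by_contra hcon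
  simp only [Set.mem_iUnion, not_exists] at hcon
  choose K hK using fun σ => M.exists_eLpNorm_le_of_notMem_spectrum σ (hcon σ)
  -- There are finitely many vertices, so the largest of their constants serves all of them.
  obtain ⟨K', hK'⟩ := M.exists_eLpNorm_le_box (c := t) (K := Finset.univ.sup K)
    fun σ z hz hz0 => (hK σ z hz hz0).trans (by
      gcongr
      exact Finset.le_sup (Finset.mem_univ σ))
  -- The three terms are the tolerance of the approximate eigenfunction, the cost of replacing `s k`
  -- by `t`, and the commutator error. Once their total times `K'` is below 1, the lower bound
  -- contradicts `0 < ‖z‖ < ∞`.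
  have hlim : Tendsto (fun k : ℕ => (K' : ℝ) * (1 / ((k : ℝ) + 1) + ‖s k - t‖ +
      1 / ((k : ℝ) + 1))) atTop (𝓝 0) := by
    have h1 := tendsto_one_div_add_atTop_nhds_zero_nat (𝕜 := ℝ)
    have h2 : Tendsto (fun k => ‖s k - t‖) atTop (𝓝 0) := tendsto_iff_norm_sub_tendsto_zero.1 hst
    simpa using ((h1.add h2).add h1).const_mul (K' : ℝ)
  obtain ⟨k, hk⟩ := (hlim.eventually (gt_mem_nhds one_pos)).exists
  obtain ⟨z, hz, hz2, hz0, hne, hres⟩ := M.exists_approx_of_mem_spectrum_softOperator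
    (isOpen_box l).measurableSet (by positivity) (hs k) (δ := 1 / ((k : ℝ) + 1)) (by positivity)
  rw [smul_mem_box_iff] at hz0 hres
  have hEm := (M.isOpen_soft.inter (isOpen_box fun j => (φ k + 1) * l j)).measurableSet
  have hest := hK' (fun j => (φ k + 1) * l j) (φ k + 1) (φ k).succ_pos
    (fun j => Nat.le_mul_of_pos_right _ (hl j)) z hz hz2 hz0
  have hres' : eLpNorm ((M.soft ∩ box fun j => (φ k + 1) * l j).indicator (M.resid t z)) 2 volume ≤
      ENNReal.ofReal (1 / ((k : ℝ) + 1) + ‖s k - t‖) * eLpNorm z 2 volume := by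
    have hm1 := ((M.memLp_resid (s k) hz hz2).indicator hEm).1
    calc _ ≤ eLpNorm ((M.soft ∩ box fun j => (φ k + 1) * l j).indicator (M.resid (s k) z) +
          (s k - t) • z) 2 volume := by
          refine eLpNorm_mono_ae ?_
          filter_upwards [hz0] with x hx
          rw [Pi.add_apply, Pi.smul_apply, smul_eq_mul]
          by_cases hxE : x ∈ M.soft ∩ box fun j => (φ k + 1) * l j
          · rw [Set.indicator_of_mem hxE, Set.indicator_of_mem hxE, resid, resid]
            refine le_of_eq (congrArg _ ?_)
            ring
          · rw [Set.indicator_of_notMem hxE, norm_zero]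
            exact norm_nonneg _
      _ ≤ _ := eLpNorm_add_le hm1 (hz2.const_smul _).1 (by norm_num)
      _ ≤ _ := by
          rw [eLpNorm_const_smul, ENNReal.ofReal_add (by positivity) (norm_nonneg _), add_mul,
            ofReal_norm]
          gcongr
  have hn : ((1 / (φ k + 1 : ℕ) : ℝ≥0) : ℝ≥0∞) ≤ ENNReal.ofReal (1 / ((k : ℝ) + 1)) := by
    rw [← ENNReal.ofReal_coe_nnreal]
    refine ENNReal.ofReal_le_ofReal ?_
    push_cast
    have : (k : ℝ) ≤ φ k := by exact_mod_cast hφ.le_apply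
    gcongr
  have hfinal : eLpNorm z 2 volume ≤ ENNReal.ofReal ((K' : ℝ) * (1 / ((k : ℝ) + 1) + ‖s k - t‖ +
      1 / ((k : ℝ) + 1))) * eLpNorm z 2 volume := by
    refine hest.trans ?_
    rw [ENNReal.ofReal_mul (NNReal.coe_nonneg K'), ENNReal.ofReal_coe_nnreal,
      ENNReal.ofReal_add (by positivity) (by positivity), mul_assoc, add_mul]
    gcongr
  have hlt : ENNReal.ofReal ((K' : ℝ) * (1 / ((k : ℝ) + 1) + ‖s k - t‖ + 1 / ((k : ℝ) + 1))) *
      eLpNorm z 2 volume < 1 * eLpNorm z 2 volume :=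
    ENNReal.mul_lt_mul_left hne hz2.2.ne (by simpa using ENNReal.ofReal_lt_one.2 hk)
  rw [one_mul] at hlt
  exact hfinal.not_gt hlt

end Medium

end HighContrast

theorem theorem5p5 {d : ℕ} (hd : 0 < d) (𝕜 : Type*) [RCLike 𝕜] (M : HighContrast.Medium d)
    (l : Fin d → ℕ) (hl : ∀ j, 0 < l j) :
    HighContrast.IsHausdorffLimit
      (fun N : ℕ => spectrum 𝕜 (M.softOperator 𝕜 (HighContrast.box l) (1 / ((N : ℝ) + 1))))
      (⋃ σ : Fin d → Bool, spectrum 𝕜 (M.vertexOperator 𝕜 σ)) := by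
  refine ⟨fun t ht => ?_, fun φ s t hφ hs hst => ?_⟩
  · obtain ⟨σ, hσ⟩ := Set.mem_iUnion.1 ht
    exact M.exists_tendsto_of_mem_spectrum_vertexOperator hl σ hσ
  · exact M.mem_iUnion_spectrum_vertexOperator_of_tendsto hl hφ hs hst
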